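/- Let $n\ge 1$, let $B_r\subset\mathbb R^n$ be the open ball of radius $r$ centred at $0$, and let $\mathcal S^{n\times n}$ be the space of real symmetric $n\times n$ matrices. For $p\in\mathbb R^n$ and $M\in\mathcal S^{n\times n}$ let $\hat p=(-p_1,p_2,\dots,p_n)$, and let $\widehat M$ be obtained from $M$ by changing the sign of the entries $M_{1j}$ and $M_{j1}$, $2\le j\le n$. Let $F\in C^1\big((\overline B_1\setminus\{0\})\times\mathbb R\times\mathbb R^n\times\mathcal S^{n\times n}\big)$ be such that the matrix $\big(\frac{\partial F}{\partial M_{ij}}(x,s,p,M)\big)$ is positive definite for all $(x,s,p,M)\in(\overline B_1\setminus\{0\})\times\mathbb R\times\mathbb R^n\times\mathcal S^{n\times n}$. Suppose that for all $x\in B_1$ with $0<x_1<1$, all $\hat x_1$ with $-1<\hat x_1\le x_1$, $x_1+\hat x_1>0$ and $(\hat x_1,x_2,\dots,x_n)\neq 0$, and all $s\in\mathbb R$, $p\in\mathbb R^n$, $M\in\mathcal S^{n\times n}$, $$F(\hat x_1,x_2,\dots,x_n,s,\hat p,\widehat M)\ \ge\ F(x_1,x_2,\dots,x_n,s,p,M).$$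 Let $u\in C^2(\overline B_1\setminus\{0\})$ satisfy $$F(x,u,\nabla u,\nabla^2u)=0,\quad u>0\quad\text{in } B_1\setminus\{0\},\qquad u=0\quad\text{on }\partial B_1,$$ and suppose that there is some $\bar r\in(0,1]$ such that for every $V\in\mathbb R^n$ the function $w(x):=u(x)+V\cdot x$ satisfies $$\inf_{B_r\setminus\{0\}}w=\min_{\partial B_r}w\qquad\text{for all } 0<r<\bar r .$$ Then $$\frac{\partial u}{\partial x_1}(x)<0\qquad\text{for all } x\in B_1 \text{ with } 0<x_1<1 .$$ -/

import Mathlib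

open Metric Set

namespace MovingPlanes

/-- The Euclidean space `ℝⁿ`. -/
abbrev E (n : ℕ) : Type := EuclideanSpace ℝ (Fin n)

/-- The real symmetric `n × n` matrices, as a subspace of all matrices. -/
def symSubmodule (n : ℕ) : Submodule ℝ (Matrix (Fin n) (Fin n) ℝ) where
  carrier := {M | M.IsSymm}
  add_mem' ha hb := ha.add hb
  zero_mem' := Matrix.isSymm_zero
  smul_mem' c _ h := h.smul c

/-- The space `𝒮ⁿˣⁿ` of real symmetric `n × n` matrices. -/
def SymMat (n : ℕ) : Type := symSubmodule n

-- The space carries the entrywise maximum norm. Any norm serves: it only fixes the (unique)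
-- finite-dimensional topology in which the regularity of `F` is understood.
noncomputable instance (n : ℕ) : NormedAddCommGroup (SymMat n) :=
  letI : NormedAddCommGroup (Matrix (Fin n) (Fin n) ℝ) := Matrix.normedAddCommGroup
  inferInstanceAs (NormedAddCommGroup (symSubmodule n))

noncomputable instance (n : ℕ) : NormedSpace ℝ (SymMat n) :=
  letI : NormedAddCommGroup (Matrix (Fin n) (Fin n) ℝ) := Matrix.normedAddCommGroup
  letI : NormedSpace ℝ (Matrix (Fin n) (Fin n) ℝ) := Matrix.normedSpace
  inferInstanceAs (NormedSpace ℝ (symSubmodule n))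

/-- The inclusion of the symmetric matrices into all matrices. -/
noncomputable def SymMat.toMat {n : ℕ} : SymMat n →ₗ[ℝ] Matrix (Fin n) (Fin n) ℝ :=
  (symSubmodule n).subtype

/-- A symmetric matrix as an element of `𝒮ⁿˣⁿ`. -/
def SymMat.mk {n : ℕ} (A : Matrix (Fin n) (Fin n) ℝ) (h : A.IsSymm) : SymMat n := ⟨A, h⟩

@[simp]
theorem SymMat.toMat_mk {n : ℕ} (A : Matrix (Fin n) (Fin n) ℝ) (h : A.IsSymm) :
    SymMat.toMat (SymMat.mk A h) = A := rfl

theorem SymMat.toMat_injective {n : ℕ} : Function.Injective (SymMat.toMat (n := n)) :=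
  Subtype.val_injective

theorem SymMat.isSymm_toMat {n : ℕ} (M : SymMat n) : (SymMat.toMat M).IsSymm := M.2

instance (n : ℕ) : FiniteDimensional ℝ (SymMat n) :=
  FiniteDimensional.of_injective SymMat.toMat SymMat.toMat_injective

/-- The arguments `(x, s, p, M)` of a second order operator `F(x, s, p, M)`. -/
abbrev Jet (n : ℕ) : Type := E n × ℝ × E n × SymMat n

/-- The punctured closed unit ball. -/
def puncturedClosedBall (n : ℕ) : Set (E n) := closedBall 0 1 \ {0}

/-- The punctured open unit ball. -/
def puncturedBall (n : ℕ) : Set (E n) := ball 0 1 \ {0}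

/-- The symmetric matrix `(e_i e_jᵀ + e_j e_iᵀ) / 2`. -/
noncomputable def symUnit {n : ℕ} (i j : Fin n) : SymMat n :=
  SymMat.mk ((2⁻¹ : ℝ) • (Matrix.single i j (1 : ℝ) + Matrix.single j i (1 : ℝ))) (by
    exact Matrix.IsSymm.smul (by simp [Matrix.IsSymm, add_comm]) _)

/-- The matrix `(∂F/∂M_{ij})(x, s, p, M)`: the symmetric matrix `A` for which the differential of
`F` in the symmetric-matrix variable is `N ↦ ∑ i j, A i j * N i j`. -/
noncomputable def partialM {n : ℕ} (F : Jet n → ℝ) (x : E n) (s : ℝ) (p : E n) (M : SymMat n) :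
    Matrix (Fin n) (Fin n) ℝ :=
  Matrix.of fun i j => fderiv ℝ (fun N : SymMat n => F (x, s, p, N)) M (symUnit i j)

/-- The Hessian matrix of `u` at `x`. The symmetrization changes nothing at points near which
`u` is `C²`. -/
noncomputable def hessian {n : ℕ} (u : E n → ℝ) (x : E n) : SymMat n :=
  SymMat.mk (Matrix.of fun i j =>
      (fderiv ℝ (fderiv ℝ u) x (EuclideanSpace.single i 1) (EuclideanSpace.single j 1) +
        fderiv ℝ (fderiv ℝ u) x (EuclideanSpace.single j 1) (EuclideanSpace.single i 1)) / 2)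
    (Matrix.IsSymm.ext fun i j => by simp [add_comm])

/-- The point `(t, x₂, …, xₙ)`. -/
noncomputable def setFirst {n : ℕ} [NeZero n] (x : E n) (t : ℝ) : E n :=
  WithLp.toLp 2 (Function.update x.ofLp 0 t)

/-- `p̂ = (-p₁, p₂, …, pₙ)`. -/
noncomputable def hatVec {n : ℕ} [NeZero n] (p : E n) : E n := setFirst p (-(p 0))

/-- `M̂`: the entries in which exactly one index is the first one change sign. -/
noncomputable def hatMat {n : ℕ} [NeZero n] (M : SymMat n) : SymMat n :=
  SymMat.mk
    (Matrix.of fun i j => if (i = 0 ↔ j = 0) then SymMat.toMat M i j else -(SymMat.toMat M i j))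
    (Matrix.IsSymm.ext fun i j => by
      simp [M.isSymm_toMat.apply i j, iff_comm])

/-- The operator is elliptic on the punctured closed ball: `(∂F/∂M_{ij})` is positive definite. -/
def Elliptic {n : ℕ} (F : Jet n → ℝ) : Prop :=
  ∀ x ∈ puncturedClosedBall n, ∀ (s : ℝ) (p : E n) (M : SymMat n), (partialM F x s p M).PosDef

/-- The reflection monotonicity condition on `F`. As `F` lives off the origin, the points with
`(t, x₂, …, xₙ) = 0` are left out. -/
def ReflectionMonotone {n : ℕ} [NeZero n] (F : Jet n → ℝ) : Prop :=
  ∀ x ∈ ball (0 : E n) 1, ∀ t : ℝ, 0 < x 0 → x 0 < 1 → -1 < t → t ≤ x 0 → 0 < x 0 + t →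
    setFirst x t ≠ 0 →
    ∀ (s : ℝ) (p : E n) (M : SymMat n),
      F (x, s, p, M) ≤ F (setFirst x t, s, hatVec p, hatMat M)

/-- For every `V ∈ ℝⁿ` the function `w(x) = u(x) + V · x` satisfies
`inf_{B_r ∖ {0}} w = min_{∂B_r} w` for all `0 < r < R`
(in particular the infimum is finite and the minimum is attained). -/
def SuperaffineNearZero {n : ℕ} (u : E n → ℝ) (R : ℝ) : Prop :=
  ∀ V : E n, ∀ r : ℝ, 0 < r → r < R →
    ∃ m : ℝ, IsLeast ((fun x => u x + inner ℝ V x) '' sphere 0 r) m ∧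
      IsGLB ((fun x => u x + inner ℝ V x) '' (ball 0 r \ {0})) m

end MovingPlanes

/-! The proof moves the planes `x₁ = l` from `l = 1` down towards `l = 0`, comparing `u` on each cap
`x₁ ≥ l` with its reflection `u ∘ refl l`. By the reflection condition `u ∘ refl l` is a
supersolution (`supersolution`). The cap avoids the origin when `l > 0`, so `u` is a regular
solution there. The difficulty is the point `refl l 0`, which may lie in the cap and at which the
reflected function is singular.

The difference `w = u ∘ refl l - u` is touched from below by quadratic polynomials `q`. At a contact
point with `w = q`, the gradients of `w` and `q` agree and the Hessian of `w` dominates that of `q`.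
Ellipticity and the supersolution property then force `F ≤ 0` at the jet of `u + q`, while a mean
value estimate for `F` over a compact set of jets makes this quantity positive for suitable `q`. In
`barrier` such `q` are found near any point `z`, with a small linear term `⟨A, x - z⟩` left free.

That freedom handles the singularity. If `z = refl l 0` is approached by a touching ball of points
of strict inequality, comparison off `z` for all small `A` gives `w ≥ κ ‖x - z‖ + δ h` with `h`
smooth and `h z = 0`. So near `0` the function `u` lies above a cone of positive slope over an
affine function with value `u z` at `0`. Cancelling the affine part by the choice of `V`, the
minimum over a small sphere lifts the lower limit of `u` at `0` strictly above `u z`. Strict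
inequality is therefore expressed by lower limits (`StrictAt`), and the strong maximum principle
`strictAt_cap` holds across the singularity.

Strictness on a compact part of the cap persists for nearby `l`. The remaining narrow strip is
controlled by `exists_strip_width`, whose width is uniform for `l ≥ l₀ > 0`. So `ReflLE u l` holds
for all `0 < l < 1` (`reflLE`), and Hopf's lemma on the plane `x₁ = l` gives the sign of `∂u/∂x₁`.
-/

namespace MovingPlanes

open Filter Topology

variable {n : ℕ}

/-! ### Symmetric matrices and ellipticity -/

/-- The rank one symmetric matrix `v vᵀ`. -/
def rankOne (v : E n) : SymMat n :=
  SymMat.mk (Matrix.vecMulVec v.ofLp v.ofLp) (Matrix.IsSymm.ext fun i j => by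
    simp [Matrix.vecMulVec_apply, mul_comm])

theorem SymMat.eq_sum (N : SymMat n) :
    N = ∑ i, ∑ j, SymMat.toMat N i j • symUnit i j := by
  apply SymMat.toMat_injective
  simp only [map_sum, map_smul, symUnit, SymMat.toMat_mk]
  ext k l
  simp only [Matrix.sum_apply, Matrix.smul_apply, Matrix.add_apply, Matrix.single_apply,
    smul_eq_mul]
  have h1 : ∀ i j : Fin n, SymMat.toMat N i j * (2⁻¹ * ((if i = k ∧ j = l then (1 : ℝ) else 0) +
      if j = k ∧ i = l then 1 else 0)) =
      (if i = k then (if j = l then 2⁻¹ * SymMat.toMat N k l else 0) else 0) +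
      (if i = l then (if j = k then 2⁻¹ * SymMat.toMat N l k else 0) else 0) := by
    intro i j
    by_cases h1 : i = k <;> by_cases h2 : j = l <;> by_cases h3 : i = l <;> by_cases h4 : j = k <;>
      simp_all <;> ring
  simp only [h1, Finset.sum_add_distrib, Finset.sum_ite_eq', Finset.sum_ite_irrel,
    Finset.sum_const_zero, Finset.mem_univ, if_true]
  rw [N.isSymm_toMat.apply k l]
  ring

/-- The domain of the operator `F`. -/
def jetDomain (n : ℕ) : Set (Jet n) := puncturedClosedBall n ×ˢ univ

theorem puncturedClosedBall_eq : puncturedClosedBall n = closedBall 0 1 ∩ {0}ᶜ := rfl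

theorem uniqueDiffOn_puncturedClosedBall : UniqueDiffOn ℝ (puncturedClosedBall n) := by
  rw [puncturedClosedBall_eq]
  refine UniqueDiffOn.inter ?_ isOpen_compl_singleton
  apply uniqueDiffOn_convex (convex_closedBall _ _)
  exact ⟨0, mem_interior_iff_mem_nhds.2 (closedBall_mem_nhds _ one_pos)⟩

theorem uniqueDiffOn_jetDomain : UniqueDiffOn ℝ (jetDomain n) :=
  uniqueDiffOn_puncturedClosedBall.prod uniqueDiffOn_univ

/-- The full derivative of `F` within its domain. -/
noncomputable def opDeriv (F : Jet n → ℝ) (J : Jet n) : Jet n →L[ℝ] ℝ :=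
  fderivWithin ℝ F (jetDomain n) J

variable {F : Jet n → ℝ}

theorem continuousOn_opDeriv (hF : ContDiffOn ℝ 1 F (jetDomain n)) :
    ContinuousOn (opDeriv F) (jetDomain n) :=
  hF.continuousOn_fderivWithin uniqueDiffOn_jetDomain le_rfl

/-- With `x` fixed the remaining variables range over a whole vector space, so the derivative within
the domain restricts to a genuine derivative, even when `‖x‖ = 1`. -/
theorem hasFDerivAt_jet (hF : ContDiffOn ℝ 1 F (jetDomain n)) {x : E n}
    (hx : x ∈ puncturedClosedBall n) (j : ℝ × E n × SymMat n) :
    HasFDerivAt (fun j => F (x, j))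
      ((opDeriv F (x, j)).comp (ContinuousLinearMap.inr ℝ (E n) (ℝ × E n × SymMat n))) j := by
  have h1 : HasFDerivWithinAt F (opDeriv F (x, j)) (jetDomain n) (x, j) :=
    ((hF.differentiableOn one_ne_zero) (x, j) ⟨hx, mem_univ _⟩).hasFDerivWithinAt
  have h2 : HasFDerivWithinAt (fun j : ℝ × E n × SymMat n => (x, j))
      (ContinuousLinearMap.inr ℝ (E n) (ℝ × E n × SymMat n)) univ j :=
    (hasFDerivAt_prodMk_right x j).hasFDerivWithinAt
  exact (h1.comp j h2 (fun y _ => ⟨hx, mem_univ _⟩)).hasFDerivAt_of_univ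

/-- Mean value theorem in the jet variables. -/
theorem exists_jet_mvt (hF : ContDiffOn ℝ 1 F (jetDomain n)) {x : E n}
    (hx : x ∈ puncturedClosedBall n) (j₁ j₂ : ℝ × E n × SymMat n) :
    ∃ j ∈ segment ℝ j₁ j₂, F (x, j₂) - F (x, j₁) = opDeriv F (x, j) (0, j₂ - j₁) := by
  obtain ⟨j, hj, h⟩ := domain_mvt (f := fun j => F (x, j)) (s := univ) (x := j₁) (y := j₂)
    (fun j _ => (hasFDerivAt_jet hF hx j).hasFDerivWithinAt) convex_univ (mem_univ _) (mem_univ _)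
  exact ⟨j, hj, by simpa using h⟩

theorem partialM_apply (hF : ContDiffOn ℝ 1 F (jetDomain n)) {x : E n}
    (hx : x ∈ puncturedClosedBall n) (s : ℝ) (p : E n) (M : SymMat n) (i j : Fin n) :
    partialM F x s p M i j = opDeriv F (x, s, p, M) (0, 0, 0, symUnit i j) := by
  have h1 : HasFDerivAt (fun N : SymMat n => (s, p, N))
      ((ContinuousLinearMap.inr ℝ ℝ (E n × SymMat n)).comp
        (ContinuousLinearMap.inr ℝ (E n) (SymMat n))) M :=
    (hasFDerivAt_prodMk_right s (p, M)).comp M (hasFDerivAt_prodMk_right p M)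
  have h2 := (hasFDerivAt_jet hF hx (s, p, M)).comp M h1
  have h3 : (fun N : SymMat n => F (x, s, p, N)) =
    (fun j => F (x, j)) ∘ (fun N : SymMat n => (s, p, N)) := rfl
  simp only [partialM, Matrix.of_apply]
  rw [h3, h2.fderiv]
  simp

theorem opDeriv_matrix (hF : ContDiffOn ℝ 1 F (jetDomain n)) {x : E n}
    (hx : x ∈ puncturedClosedBall n) (s : ℝ) (p : E n) (M N : SymMat n) :
    opDeriv F (x, s, p, M) (0, 0, 0, N) =
      ∑ i, ∑ j, SymMat.toMat N i j * partialM F x s p M i j := by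
  set T : SymMat n →L[ℝ] ℝ := (opDeriv F (x, s, p, M)).comp
    ((ContinuousLinearMap.inr ℝ (E n) (ℝ × E n × SymMat n)).comp
    ((ContinuousLinearMap.inr ℝ ℝ (E n × SymMat n)).comp
        (ContinuousLinearMap.inr ℝ (E n) (SymMat n)))) with hT
  have h : ∀ N, opDeriv F (x, s, p, M) (0, 0, 0, N) = T N := fun N => by simp [hT]
  simp only [partialM_apply hF hx, h]
  conv_lhs => rw [N.eq_sum]
  simp only [map_sum, map_smul, smul_eq_mul]

theorem opDeriv_rankOne_pos (hF : ContDiffOn ℝ 1 F (jetDomain n)) (hell : Elliptic F) {x : E n}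
    (hx : x ∈ puncturedClosedBall n) (j : ℝ × E n × SymMat n) {v : E n} (hv : v ≠ 0) :
    0 < opDeriv F (x, j) (0, 0, 0, rankOne v) := by
  obtain ⟨s, p, M⟩ := j
  rw [opDeriv_matrix hF hx]
  have hv' : v.ofLp ≠ 0 := fun h => hv (by ext i; simpa using congrFun h i)
  have := (hell x hx s p M).dotProduct_mulVec_pos hv'
  refine this.trans_eq ?_
  simp only [dotProduct, Matrix.mulVec, rankOne, SymMat.toMat_mk, Matrix.vecMulVec_apply,
    Pi.star_apply, star_trivial, Finset.mul_sum]
  exact Finset.sum_congr rfl fun i _ => Finset.sum_congr rfl fun j _ => by ring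

/-- A positive semidefinite matrix is a sum of rank one matrices `v vᵀ`, and on each of these the
differential is the quadratic form of `∂F/∂M` at `v`. -/
theorem opDeriv_posSemidef_nonneg (hF : ContDiffOn ℝ 1 F (jetDomain n)) (hell : Elliptic F)
    {x : E n} (hx : x ∈ puncturedClosedBall n) (j : ℝ × E n × SymMat n) {N : SymMat n}
    (hN : (SymMat.toMat N).PosSemidef) :
    0 ≤ opDeriv F (x, j) (0, 0, 0, N) := by
  obtain ⟨s, p, M⟩ := j
  rw [opDeriv_matrix hF hx]
  obtain ⟨m, A, hA⟩ := Matrix.posSemidef_iff_eq_sum_vecMulVec.mp hN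
  have : ∑ i, ∑ j, SymMat.toMat N i j * partialM F x s p M i j =
      ∑ k, star (A k) ⬝ᵥ (partialM F x s p M).mulVec (A k) := by
    simp only [hA, Matrix.sum_apply, Matrix.vecMulVec_apply, dotProduct, Matrix.mulVec,
      Pi.star_apply, star_trivial, Finset.mul_sum, Finset.sum_mul]
    rw [Finset.sum_congr rfl fun i _ => Finset.sum_comm, Finset.sum_comm]
    refine Finset.sum_congr rfl fun k _ => ?_
    exact Finset.sum_congr rfl fun i _ => Finset.sum_congr rfl fun j _ => by ring
  rw [this]
  exact Finset.sum_nonneg fun k _ =>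
    (hell x hx s p M).posSemidef.dotProduct_mulVec_nonneg _

/-- `F` is nondecreasing in the matrix variable. -/
theorem le_of_posSemidef (hF : ContDiffOn ℝ 1 F (jetDomain n)) (hell : Elliptic F)
    {x : E n} (hx : x ∈ puncturedClosedBall n) (s : ℝ) (p : E n) {M N : SymMat n}
    (h : (SymMat.toMat (N - M)).PosSemidef) : F (x, s, p, M) ≤ F (x, s, p, N) := by
  obtain ⟨j, -, hj⟩ := exists_jet_mvt hF hx (s, p, M) (s, p, N)
  have := opDeriv_posSemidef_nonneg hF hell hx j h
  simp only [Prod.mk_sub_mk, sub_self] at hj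
  linarith

/-- Bounds for the derivative of `F` on a compact set of jets. -/
theorem exists_opDeriv_bounds (hF : ContDiffOn ℝ 1 F (jetDomain n)) (hell : Elliptic F)
    {K : Set (Jet n)} (hK : IsCompact K) (hKS : K ⊆ jetDomain n) {v : E n} (hv : v ≠ 0) :
    ∃ C > 0, ∃ c > 0, ∀ J ∈ K, (∀ H, |opDeriv F J H| ≤ C * ‖H‖) ∧
      c ≤ opDeriv F J (0, 0, 0, rankOne v) := by
  have hc := (continuousOn_opDeriv hF).mono hKS
  obtain ⟨C, hC⟩ := hK.exists_bound_of_continuousOn hc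
  have hc' : ContinuousOn (fun J => opDeriv F J (0, 0, 0, rankOne v)) K :=
    hc.clm_apply continuousOn_const
  have hpos : ∀ J ∈ K, 0 < opDeriv F J (0, 0, 0, rankOne v) := fun J hJ =>
    opDeriv_rankOne_pos hF hell (hKS hJ).1 J.2 hv
  obtain ⟨c, hc0, hcc⟩ := hK.exists_forall_le' hc' hpos
  refine ⟨max C 1, by positivity, c, hc0, fun J hJ => ⟨fun H => ?_, hcc J hJ⟩⟩
  exact ((opDeriv F J).le_opNorm H).trans
    (mul_le_mul_of_nonneg_right ((hC J hJ).trans (le_max_left _ _)) (norm_nonneg _))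

/-! ### Two-jets of functions -/

/-- The symmetric matrix of the symmetrization of a bilinear form. -/
noncomputable def bilinMat : (E n →L[ℝ] E n →L[ℝ] ℝ) →ₗ[ℝ] SymMat n where
  toFun D := SymMat.mk (Matrix.of fun i j =>
      (D (EuclideanSpace.single i 1) (EuclideanSpace.single j 1) +
        D (EuclideanSpace.single j 1) (EuclideanSpace.single i 1)) / 2)
    (Matrix.IsSymm.ext fun i j => by simp [add_comm])
  map_add' D D' := by
    apply SymMat.toMat_injective
    rw [map_add]
    ext i j
    simp
    ring
  map_smul' c D := by
    apply SymMat.toMat_injective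
    rw [map_smul]
    ext i j
    simp
    ring

theorem hessian_eq_bilinMat (u : E n → ℝ) (x : E n) :
    hessian u x = bilinMat (fderiv ℝ (fderiv ℝ u) x) := rfl

theorem SymMat.norm_le_iff {N : SymMat n} {r : ℝ} (hr : 0 ≤ r) :
    ‖N‖ ≤ r ↔ ∀ i j, |SymMat.toMat N i j| ≤ r := by
  let _ : NormedAddCommGroup (Matrix (Fin n) (Fin n) ℝ) := Matrix.normedAddCommGroup
  have h : ‖N‖ = ‖SymMat.toMat N‖ := rfl
  rw [h, Matrix.norm_le_iff hr]
  simp only [Real.norm_eq_abs]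

theorem norm_bilinMat_le (D : E n →L[ℝ] E n →L[ℝ] ℝ) : ‖bilinMat D‖ ≤ ‖D‖ := by
  refine (SymMat.norm_le_iff (norm_nonneg D)).2 fun i j => ?_
  have h : ∀ i j : Fin n, |D (EuclideanSpace.single i 1) (EuclideanSpace.single j 1)| ≤ ‖D‖ := by
    intro i j
    simpa using D.le_opNorm₂ (EuclideanSpace.single i 1) (EuclideanSpace.single j 1)
  have h1 := abs_le.1 (h i j)
  have h2 := abs_le.1 (h j i)
  simp only [bilinMat, LinearMap.coe_mk, AddHom.coe_mk, SymMat.toMat_mk, Matrix.of_apply]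
  rw [abs_le]
  constructor <;> linarith [h1.1, h1.2, h2.1, h2.2]

theorem sum_single (v : E n) : ∑ i, v i • EuclideanSpace.single i (1 : ℝ) = v := by
  ext j
  simp [Finset.sum_apply, Pi.single_apply]

theorem dotProduct_bilinMat (D : E n →L[ℝ] E n →L[ℝ] ℝ) (v : Fin n → ℝ) :
    star v ⬝ᵥ (SymMat.toMat (bilinMat D)).mulVec v = D (WithLp.toLp 2 v) (WithLp.toLp 2 v) := by
  have h : D (WithLp.toLp 2 v) (WithLp.toLp 2 v) = ∑ i, ∑ j, v i * v j *
      D (EuclideanSpace.single i 1) (EuclideanSpace.single j 1) := by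
    conv_lhs => rw [← sum_single (WithLp.toLp 2 v)]
    simp only [map_sum, map_smul, sum_apply,
      FunLike.coe_smul, Pi.smul_apply, smul_eq_mul, Finset.mul_sum]
    rw [Finset.sum_comm]
    exact Finset.sum_congr rfl fun i _ => Finset.sum_congr rfl fun j _ => by ring
  have h' : D (WithLp.toLp 2 v) (WithLp.toLp 2 v) = ∑ i, ∑ j, v i * v j *
      D (EuclideanSpace.single j 1) (EuclideanSpace.single i 1) := by
    rw [h, Finset.sum_comm]
    exact Finset.sum_congr rfl fun i _ => Finset.sum_congr rfl fun j _ => by ring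
  have h2 : star v ⬝ᵥ (SymMat.toMat (bilinMat D)).mulVec v =
      ((∑ i, ∑ j, v i * v j * D (EuclideanSpace.single i 1) (EuclideanSpace.single j 1)) +
      ∑ i, ∑ j, v i * v j * D (EuclideanSpace.single j 1) (EuclideanSpace.single i 1)) / 2 := by
    simp only [dotProduct, Matrix.mulVec, bilinMat, Pi.star_apply, star_trivial, Finset.mul_sum,
      ← Finset.sum_add_distrib, Finset.sum_div]
    exact Finset.sum_congr rfl fun i _ => Finset.sum_congr rfl fun j _ => by
      simp; ring
  rw [h2, ← h, ← h']
  ring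

theorem eventually_differentiableAt {u : E n → ℝ} {x : E n} (hu : ContDiffAt ℝ 2 u x) :
    ∀ᶠ y in 𝓝 x, DifferentiableAt ℝ u y :=
  (hu.eventually (by simp)).mono fun _ h => h.differentiableAt (by norm_num)

theorem differentiableAt_fderiv {u : E n → ℝ} {x : E n} (hu : ContDiffAt ℝ 2 u x) :
    DifferentiableAt ℝ (fderiv ℝ u) x :=
  (hu.fderiv_right (m := 1) (by norm_num)).differentiableAt (by norm_num)

theorem inner_gradient (u : E n → ℝ) (x v : E n) : inner ℝ (gradient u x) v = fderiv ℝ u x v := by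
  simp [gradient]

theorem norm_gradient (u : E n → ℝ) (x : E n) : ‖gradient u x‖ = ‖fderiv ℝ u x‖ := by
  simp [gradient]

theorem gradient_sub {u v : E n → ℝ} {x : E n} (hu : DifferentiableAt ℝ u x)
    (hv : DifferentiableAt ℝ v x) :
    gradient (fun y => u y - v y) x = gradient u x - gradient v x := by
  simp only [gradient]
  rw [fderiv_fun_sub hu hv, map_sub]

theorem hessian_sub {u v : E n → ℝ} {x : E n} (hu : ContDiffAt ℝ 2 u x)
    (hv : ContDiffAt ℝ 2 v x) :
    hessian (fun y => u y - v y) x = hessian u x - hessian v x := by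
  simp only [hessian_eq_bilinMat]
  rw [← map_sub, ← fderiv_sub (differentiableAt_fderiv hu) (differentiableAt_fderiv hv)]
  congr 1
  apply Filter.EventuallyEq.fderiv_eq
  filter_upwards [eventually_differentiableAt hu, eventually_differentiableAt hv] with y h1 h2
  exact fderiv_fun_sub h1 h2

/-- Necessary conditions for a local minimum. -/
theorem gradient_eq_zero_of_isLocalMin {f : E n → ℝ} {x : E n} (h : IsLocalMin f x) :
    gradient f x = 0 := by
  simp [gradient, h.fderiv_eq_zero]

theorem posSemidef_hessian_of_isLocalMin {f : E n → ℝ} {x : E n} (hf : ContDiffAt ℝ 2 f x)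
    (h : IsLocalMin f x) : (SymMat.toMat (hessian f x)).PosSemidef := by
  refine Matrix.PosSemidef.of_dotProduct_mulVec_nonneg ?_ fun v => ?_
  · rw [Matrix.IsHermitian, Matrix.conjTranspose_eq_transpose_of_trivial]
    exact (hessian f x).isSymm_toMat
  rw [hessian_eq_bilinMat, dotProduct_bilinMat]
  set w : E n := WithLp.toLp 2 v
  by_contra! hneg
  set φ : ℝ → ℝ := fun t => f (x + t • w)
  have hline : ∀ t : ℝ, HasDerivAt (fun t : ℝ => x + t • w) w t := fun t => by
    simpa using ((hasDerivAt_id t).smul_const w).const_add x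
  have hcont : Continuous fun t : ℝ => x + t • w := by fun_prop
  have htend : Tendsto (fun t : ℝ => x + t • w) (𝓝 0) (𝓝 x) := by
    have := hcont.tendsto 0
    simpa using this
  have h1 : ∀ᶠ t in 𝓝 (0 : ℝ), deriv φ t = fderiv ℝ f (x + t • w) w := by
    filter_upwards [htend.eventually (eventually_differentiableAt hf)] with t ht
    exact (ht.hasFDerivAt.comp_hasDerivAt t (hline t)).deriv
  have h2 : deriv (deriv φ) 0 = fderiv ℝ (fderiv ℝ f) x w w := by
    rw [Filter.EventuallyEq.deriv_eq h1]
    have h3 : HasFDerivAt (fderiv ℝ f) (fderiv ℝ (fderiv ℝ f) x) (x + (0 : ℝ) • w) := by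
      simpa using (differentiableAt_fderiv hf).hasFDerivAt
    have h4 : HasFDerivAt (fun y => fderiv ℝ f y w)
        ((fderiv ℝ (fderiv ℝ f) x).flip w) (x + (0 : ℝ) • w) := by
      have := h3.clm_apply (hasFDerivAt_const w (x + (0 : ℝ) • w))
      simpa using this
    exact (h4.comp_hasDerivAt (0 : ℝ) (hline 0)).deriv
  have h5 : deriv φ 0 = 0 := by
    rw [h1.self_of_nhds]
    simp [h.fderiv_eq_zero]
  have h6 : ContinuousAt φ 0 := by
    refine ContinuousAt.comp (g := f) ?_ hcont.continuousAt
    simpa using hf.continuousAt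
  -- A negative second derivative makes `0` a local maximum as well as a local minimum, so `φ` is
  -- locally constant and its second derivative vanishes.
  have hmax : IsLocalMax φ 0 := isLocalMax_of_deriv_deriv_neg (by rw [h2]; exact hneg) h5 h6
  have hmin : ∀ᶠ t in 𝓝 (0 : ℝ), φ 0 ≤ φ t := by
    filter_upwards [htend.eventually h] with t ht
    simpa [φ] using ht
  have hconst : φ =ᶠ[𝓝 0] fun _ => φ 0 := by
    filter_upwards [hmax, hmin] with t a b
    exact le_antisymm a b
  have h7 : deriv φ =ᶠ[𝓝 0] fun _ => 0 := by
    filter_upwards [hconst.eventuallyEq_nhds] with t ht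
    rw [ht.deriv_eq]
    simp
  have : deriv (deriv φ) 0 = 0 := by
    rw [h7.deriv_eq]
    simp
  rw [h2] at this
  linarith

/-! ### Quadratic test functions -/

/-- The identity as a symmetric matrix. -/
def idMat (n : ℕ) : SymMat n := SymMat.mk 1 Matrix.isSymm_one

/-- A quadratic polynomial centred at `z`. -/
noncomputable def quad (z ν : E n) (α : ℝ) (β : E n) (κ μ : ℝ) (x : E n) : ℝ :=
  α + inner ℝ β (x - z) + κ * ‖x - z‖ ^ 2 + μ * (inner ℝ ν (x - z)) ^ 2

theorem contDiff_quad (z ν : E n) (α : ℝ) (β : E n) (κ μ : ℝ) {m : WithTop ℕ∞} :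
    ContDiff ℝ m (quad z ν α β κ μ) := by
  unfold quad
  have h : ContDiff ℝ m fun x : E n => x - z := contDiff_id.sub contDiff_const
  have h1 : ∀ w : E n, ContDiff ℝ m fun x : E n => (inner ℝ w (x - z) : ℝ) := fun w =>
    contDiff_const.inner ℝ h
  exact ((contDiff_const.add (h1 β)).add (contDiff_const.mul (h.norm_sq ℝ))).add
    (contDiff_const.mul ((h1 ν).pow 2))

theorem fderiv_quad (z ν : E n) (α : ℝ) (β : E n) (κ μ : ℝ) (x : E n) :
    fderiv ℝ (quad z ν α β κ μ) x = innerSL ℝ β + (2 * κ) • innerSL ℝ (x - z) +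
      (2 * μ * inner ℝ ν (x - z)) • innerSL ℝ ν := by
  apply HasFDerivAt.fderiv
  have h : HasFDerivAt (fun x : E n => x - z) (ContinuousLinearMap.id ℝ (E n)) x :=
    (hasFDerivAt_id x).sub_const z
  have h1 : ∀ w : E n, HasFDerivAt (fun x : E n => (inner ℝ w (x - z) : ℝ)) (innerSL ℝ w) x :=
    fun w => ((innerSL ℝ w).hasFDerivAt.comp x h)
  have h2 := (((h1 β).const_add α).add (h.norm_sq.const_mul κ)).add
    (((h1 ν).pow 2).const_mul μ)
  refine h2.congr_fderiv ?_
  ext v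
  simp
  ring

theorem gradient_quad (z ν : E n) (α : ℝ) (β : E n) (κ μ : ℝ) (x : E n) :
    gradient (quad z ν α β κ μ) x = β + (2 * κ) • (x - z) +
      (2 * μ * inner ℝ ν (x - z)) • ν := by
  refine ext_inner_right ℝ fun v => ?_
  rw [inner_gradient, fderiv_quad]
  simp [inner_add_left, inner_smul_left, ← inner_sub_left]

theorem hessian_quad (z ν : E n) (α : ℝ) (β : E n) (κ μ : ℝ) (x : E n) :
    hessian (quad z ν α β κ μ) x = (2 * κ) • idMat n + (2 * μ) • rankOne ν := by
  have h0 : fderiv ℝ (quad z ν α β κ μ) = fun x => innerSL ℝ β + (2 * κ) • innerSL ℝ (x - z) +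
      (2 * μ * inner ℝ ν (x - z)) • innerSL ℝ ν := funext fun x => fderiv_quad z ν α β κ μ x
  have h : HasFDerivAt (fun x : E n => x - z) (ContinuousLinearMap.id ℝ (E n)) x :=
    (hasFDerivAt_id x).sub_const z
  have h1 : HasFDerivAt (fun x : E n => (inner ℝ ν (x - z) : ℝ)) (innerSL ℝ ν) x :=
    ((innerSL ℝ ν).hasFDerivAt.comp x h)
  obtain ⟨I, hI'⟩ : ∃ I : E n →L[ℝ] E n →L[ℝ] ℝ, ∀ v, I v = innerSL ℝ v :=
    ⟨innerSL ℝ, fun _ => rfl⟩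
  have hI : HasFDerivAt (fun x : E n => (innerSL ℝ (x - z) : E n →L[ℝ] ℝ)) I x := by
    simp only [← hI']
    exact I.hasFDerivAt.comp x h
  have h2 := ((hI.const_smul (2 * κ)).const_add (innerSL ℝ β)).add
    ((h1.const_mul (2 * μ)).smul_const (innerSL ℝ ν))
  have h3 : fderiv ℝ (fderiv ℝ (quad z ν α β κ μ)) x = (2 * κ) • I +
      ((2 * μ) • (innerSL ℝ) ν).smulRight ((innerSL ℝ) ν) := by
    rw [h0]
    exact h2.fderiv
  rw [hessian_eq_bilinMat, h3]
  apply SymMat.toMat_injective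
  simp only [map_add, map_smul]
  ext i j
  by_cases hij : i = j
  · subst hij
    simp [hI', bilinMat, idMat, rankOne, Matrix.vecMulVec_apply,
      EuclideanSpace.inner_single_right]
    ring
  · simp [hI', bilinMat, idMat, rankOne, Matrix.vecMulVec_apply,
      EuclideanSpace.inner_single_right, hij, Ne.symm hij]
    ring

/-- Comparison of two-jets when `U - V` is touched from below by a quadratic polynomial. -/
theorem jet_of_isLocalMin {U V q : E n → ℝ} {x : E n} (hU : ContDiffAt ℝ 2 U x)
    (hV : ContDiffAt ℝ 2 V x) (hq : ContDiffAt ℝ 2 q x)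
    (h : IsLocalMin (fun y => U y - V y - q y) x) :
    gradient U x = gradient V x + gradient q x ∧
      (SymMat.toMat (hessian U x - (hessian V x + hessian q x))).PosSemidef := by
  have hUV := hU.sub hV
  have h1 := gradient_eq_zero_of_isLocalMin h
  have h2 := posSemidef_hessian_of_isLocalMin (hUV.sub hq) h
  rw [gradient_sub (hUV.differentiableAt (by norm_num)) (hq.differentiableAt (by norm_num)),
    gradient_sub (hU.differentiableAt (by norm_num)) (hV.differentiableAt (by norm_num))] at h1
  rw [hessian_sub hUV hq, hessian_sub hU hV, sub_sub] at h2
  exact ⟨by rw [sub_sub, sub_eq_zero] at h1; exact h1, h2⟩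

section Reflection

variable [NeZero n]

/-! ### Reflections in the hyperplanes `x₁ = l` -/

/-- The first basis vector. -/
noncomputable def e₁ : E n := EuclideanSpace.single 0 1

@[simp] theorem e₁_zero : (e₁ : E n) 0 = 1 := by simp [e₁]

@[simp] theorem norm_e₁ : ‖(e₁ : E n)‖ = 1 := by simp [e₁]

theorem inner_e₁ (x : E n) : inner ℝ (e₁ : E n) x = x 0 := by
  simp [e₁, EuclideanSpace.inner_single_left]

theorem e₁_ne_zero : (e₁ : E n) ≠ 0 := by
  intro h
  simpa [h] using (norm_e₁ (n := n))

/-- The reflection of `x` in the hyperplane `x₁ = l`. -/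
noncomputable def refl (l : ℝ) (x : E n) : E n := setFirst x (2 * l - x 0)

theorem refl_eq (l : ℝ) (x : E n) : refl l x = x + (2 * (l - x 0)) • e₁ := by
  ext i
  by_cases hi : i = 0
  · subst hi
    simp [refl, setFirst, e₁]
    ring
  · simp [refl, setFirst, e₁, hi]

theorem hatVec_eq (x : E n) : hatVec x = x - (2 * x 0) • e₁ := by
  ext i
  by_cases hi : i = 0
  · subst hi
    simp [hatVec, setFirst, e₁]
    ring
  · simp [hatVec, setFirst, e₁, hi]

@[simp] theorem refl_zero (l : ℝ) (x : E n) : refl l x 0 = 2 * l - x 0 := by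
  simp [refl, setFirst]

@[simp] theorem refl_refl (l : ℝ) (x : E n) : refl l (refl l x) = x := by
  rw [refl_eq l (refl l x), refl_zero, refl_eq, add_assoc, ← add_smul]
  ring_nf
  simp

theorem continuous_refl : Continuous fun p : ℝ × E n => refl p.1 p.2 := by
  simp only [refl_eq]
  fun_prop

theorem continuous_refl_right (l : ℝ) : Continuous (refl l : E n → E n) := by
  simp only [funext (refl_eq l)]
  fun_prop

theorem norm_refl_sq (l : ℝ) (x : E n) : ‖refl l x‖ ^ 2 = ‖x‖ ^ 2 + 4 * l * (l - x 0) := by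
  rw [refl_eq, norm_add_sq_real, norm_smul, real_inner_smul_right, real_inner_comm, inner_e₁,
    norm_e₁, mul_one, Real.norm_eq_abs, sq_abs]
  ring

theorem dist_refl (l : ℝ) (x y : E n) : dist (refl l x) (refl l y) = dist x y := by
  have h : refl l x - refl l y = (x - y) - (2 * (x - y) 0) • e₁ := by
    rw [refl_eq, refl_eq]
    have : (x - y) 0 = x 0 - y 0 := by simp
    rw [this]
    module
  rw [dist_eq_norm, dist_eq_norm, h, ← sq_eq_sq₀ (norm_nonneg _) (norm_nonneg _),
    norm_sub_sq_real, norm_smul, real_inner_smul_right, real_inner_comm, inner_e₁, norm_e₁, mul_one,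
    Real.norm_eq_abs, sq_abs]
  ring

theorem refl_eq_self {l : ℝ} {x : E n} (h : x 0 = l) : refl l x = x := by
  rw [refl_eq, h]
  simp

theorem norm_refl_le {l : ℝ} (hl : 0 ≤ l) {x : E n} (hx : l ≤ x 0) : ‖refl l x‖ ≤ ‖x‖ := by
  rw [← sq_le_sq₀ (norm_nonneg _) (norm_nonneg _), norm_refl_sq]
  nlinarith

theorem norm_refl_lt {l : ℝ} (hl : 0 < l) {x : E n} (hx : l < x 0) : ‖refl l x‖ < ‖x‖ := by
  rw [← sq_lt_sq₀ (norm_nonneg _) (norm_nonneg _), norm_refl_sq]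
  nlinarith

theorem abs_zero_le_norm (x : E n) : |x 0| ≤ ‖x‖ := by
  simpa using PiLp.norm_apply_le x 0

/-- The linear part of the reflections. -/
noncomputable def hatL : E n →L[ℝ] E n :=
  ContinuousLinearMap.id ℝ (E n) - (2 : ℝ) • (innerSL ℝ (e₁ : E n)).smulRight (e₁ : E n)

theorem hatL_apply (x : E n) : hatL x = hatVec x := by
  simp [hatL, hatVec_eq, inner_e₁, smul_smul]

theorem hasFDerivAt_refl (l : ℝ) (x : E n) : HasFDerivAt (refl l) hatL x := by
  have h : (refl l : E n → E n) = fun x => hatL x + (2 * l) • e₁ := by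
    funext x
    rw [hatL_apply, hatVec_eq, refl_eq]
    module
  rw [h]
  exact hatL.hasFDerivAt.add_const _

theorem contDiff_refl (l : ℝ) : ContDiff ℝ 2 (refl l : E n → E n) := by
  have h : (refl l : E n → E n) = fun x => hatL x + (2 * l) • e₁ := by
    funext x
    rw [hatL_apply, hatVec_eq, refl_eq]
    module
  rw [h]
  exact hatL.contDiff.add contDiff_const

theorem inner_hatVec (p v : E n) : inner ℝ (hatVec p) v = inner ℝ p (hatVec v) := by
  have h : inner ℝ p (e₁ : E n) = p 0 := by rw [real_inner_comm, inner_e₁]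
  rw [hatVec_eq, hatVec_eq, inner_sub_left, inner_sub_right, inner_smul_left, inner_smul_right,
    inner_e₁, h]
  simp
  ring

theorem norm_hatVec (p : E n) : ‖hatVec p‖ = ‖p‖ := by
  have h := dist_refl 0 p 0
  have h0 : ∀ p : E n, refl 0 p = hatVec p := fun p => by
    rw [refl_eq, hatVec_eq]
    module
  rw [h0, h0, dist_eq_norm, dist_eq_norm, hatVec_eq 0] at h
  simpa using h

theorem norm_hatMat_le (M : SymMat n) : ‖hatMat M‖ ≤ ‖M‖ := by
  refine (SymMat.norm_le_iff (norm_nonneg M)).2 fun i j => ?_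
  have h := (SymMat.norm_le_iff (norm_nonneg M)).1 le_rfl i j
  simp only [hatMat, SymMat.toMat_mk, Matrix.of_apply]
  split_ifs
  · exact h
  · rwa [abs_neg]

theorem hatVec_single (i : Fin n) : hatVec (EuclideanSpace.single i (1 : ℝ)) =
    (if i = 0 then (-1 : ℝ) else 1) • EuclideanSpace.single i (1 : ℝ) := by
  by_cases hi : i = 0
  · subst hi
    rw [hatVec_eq, if_pos rfl, e₁]
    simp only [PiLp.single_apply, if_true]
    module
  · rw [hatVec_eq, if_neg hi]
    simp [Ne.symm hi]

theorem gradient_comp_refl {u : E n → ℝ} {l : ℝ} {x : E n}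
    (hu : DifferentiableAt ℝ u (refl l x)) :
    gradient (fun y => u (refl l y)) x = hatVec (gradient u (refl l x)) := by
  refine ext_inner_right ℝ fun v => ?_
  rw [inner_gradient, inner_hatVec, inner_gradient, ← hatL_apply]
  rw [show (fun y => u (refl l y)) = u ∘ refl l from rfl,
    (hu.hasFDerivAt.comp x (hasFDerivAt_refl l x)).fderiv]
  rfl

theorem hessian_comp_refl {u : E n → ℝ} {l : ℝ} {x : E n}
    (hu : ContDiffAt ℝ 2 u (refl l x)) :
    hessian (fun y => u (refl l y)) x = hatMat (hessian u (refl l x)) := by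
  have h1 : fderiv ℝ (fun y => u (refl l y)) =ᶠ[𝓝 x]
      fun y => (fderiv ℝ u (refl l y)).comp hatL := by
    filter_upwards [(continuous_refl_right l).continuousAt.eventually
      (eventually_differentiableAt hu)] with y hy
    exact (hy.hasFDerivAt.comp y (hasFDerivAt_refl l y)).fderiv
  have h2 : ∀ v w, fderiv ℝ (fderiv ℝ (fun y => u (refl l y))) x v w =
      fderiv ℝ (fderiv ℝ u) (refl l x) (hatL v) (hatL w) := by
    intro v w
    rw [h1.fderiv_eq]
    have h3 := (differentiableAt_fderiv hu).hasFDerivAt.comp x (hasFDerivAt_refl l x)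
    have h4 := h3.clm_comp (hasFDerivAt_const (hatL : E n →L[ℝ] E n) x)
    have h5 : fderiv ℝ (fun y => (fderiv ℝ u (refl l y)).comp hatL) x = _ := h4.fderiv
    rw [h5]
    simp
  apply SymMat.toMat_injective
  ext i j
  simp only [hessian, hatMat, SymMat.toMat_mk, Matrix.of_apply, h2, hatL_apply, hatVec_single,
    map_smul, FunLike.coe_smul, Pi.smul_apply, smul_eq_mul]
  by_cases hi : i = 0 <;> by_cases hj : j = 0 <;> simp [hi, hj]
  all_goals ring

end Reflection

/-! ### The boundary value problem -/

/-- The two-jet of a function at a point. -/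
noncomputable def jet (u : E n → ℝ) (x : E n) : ℝ × E n × SymMat n :=
  (u x, gradient u x, hessian u x)

/-- The hypotheses on `F` and `u` of the symmetry theorem. -/
structure Problem [NeZero n] (F : Jet n → ℝ) (u : E n → ℝ) : Prop where
  smooth : ContDiffOn ℝ 1 F (jetDomain n)
  elliptic : Elliptic F
  reflection : ReflectionMonotone F
  contDiffOn : ContDiffOn ℝ 2 u (puncturedClosedBall n)
  superaffine : ∃ R : ℝ, 0 < R ∧ R ≤ 1 ∧ SuperaffineNearZero u R
  eqn : ∀ x ∈ puncturedBall n, F (x, jet u x) = 0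
  pos : ∀ x ∈ puncturedBall n, 0 < u x
  bdry : ∀ x ∈ sphere (0 : E n) 1, u x = 0

theorem isOpen_puncturedBall : IsOpen (puncturedBall n) :=
  isOpen_ball.sdiff isClosed_singleton

theorem puncturedBall_subset : puncturedBall n ⊆ puncturedClosedBall n :=
  sdiff_subset_sdiff_left ball_subset_closedBall

theorem mem_puncturedBall {x : E n} : x ∈ puncturedBall n ↔ ‖x‖ < 1 ∧ x ≠ 0 := by
  simp [puncturedBall]

theorem mem_puncturedClosedBall {x : E n} : x ∈ puncturedClosedBall n ↔ ‖x‖ ≤ 1 ∧ x ≠ 0 := by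
  simp [puncturedClosedBall]

theorem puncturedClosedBall_mem_nhds {x : E n} (hx : x ∈ puncturedBall n) :
    puncturedClosedBall n ∈ 𝓝 x :=
  mem_of_superset (isOpen_puncturedBall.mem_nhds hx) puncturedBall_subset

theorem norm_idMat_le : ‖idMat n‖ ≤ 1 := by
  refine (SymMat.norm_le_iff zero_le_one).2 fun i j => ?_
  simp only [idMat, SymMat.toMat_mk, Matrix.one_apply]
  split_ifs <;> simp

theorem norm_rankOne_le {ν : E n} (hν : ‖ν‖ = 1) : ‖rankOne ν‖ ≤ 1 := by
  refine (SymMat.norm_le_iff zero_le_one).2 fun i j => ?_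
  have h : ∀ i, |ν i| ≤ 1 := fun i => by
    simpa [hν] using PiLp.norm_apply_le ν i
  simp only [rankOne, SymMat.toMat_mk, Matrix.vecMulVec_apply, abs_mul]
  exact mul_le_one₀ (h i) (abs_nonneg _) (h j)

/-- The compact set may meet the unit sphere. The derivatives within the closed domain are
continuous up to the sphere and agree with the ordinary ones inside. -/
theorem exists_jet_bound {u : E n → ℝ} (hu : ContDiffOn ℝ 2 u (puncturedClosedBall n))
    {K : Set (E n)} (hK : IsCompact K) (hKs : K ⊆ puncturedClosedBall n) :
    ∃ R > 0, ∀ x ∈ K, x ∈ puncturedBall n → ‖jet u x‖ ≤ R := by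
  have hf : ContDiffOn ℝ 1 (fderivWithin ℝ u (puncturedClosedBall n)) (puncturedClosedBall n) :=
    hu.fderivWithin uniqueDiffOn_puncturedClosedBall (by norm_num)
  have hf2 := hf.continuousOn_fderivWithin uniqueDiffOn_puncturedClosedBall le_rfl
  obtain ⟨R₀, hR₀⟩ := hK.exists_bound_of_continuousOn (hu.continuousOn.mono hKs)
  obtain ⟨R₁, hR₁⟩ := hK.exists_bound_of_continuousOn (hf.continuousOn.mono hKs)
  obtain ⟨R₂, hR₂⟩ := hK.exists_bound_of_continuousOn (hf2.mono hKs)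
  refine ⟨max 1 (max R₀ (max R₁ R₂)), by positivity, fun x hx hxb => ?_⟩
  have h1 : ∀ y ∈ puncturedBall n, fderivWithin ℝ u (puncturedClosedBall n) y = fderiv ℝ u y :=
    fun y hy => fderivWithin_of_mem_nhds (puncturedClosedBall_mem_nhds hy)
  have h2 : fderivWithin ℝ (fderivWithin ℝ u (puncturedClosedBall n)) (puncturedClosedBall n) x =
      fderiv ℝ (fderiv ℝ u) x := by
    rw [fderivWithin_of_mem_nhds (puncturedClosedBall_mem_nhds hxb)]
    apply Filter.EventuallyEq.fderiv_eq
    filter_upwards [isOpen_puncturedBall.mem_nhds hxb] with y hy using h1 y hy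
  have b0 := hR₀ x hx
  have b1 := hR₁ x hx
  have b2 := hR₂ x hx
  rw [h1 x hxb, ← norm_gradient] at b1
  rw [h2] at b2
  have b3 := (norm_bilinMat_le (fderiv ℝ (fderiv ℝ u) x)).trans b2
  rw [← hessian_eq_bilinMat] at b3
  simp only [jet, Prod.norm_mk, max_le_iff]
  exact ⟨b0.trans (by simp), b1.trans (by simp), b3.trans (by simp)⟩

theorem norm_quad_jet_le {z ν : E n} (hν : ‖ν‖ = 1) {α κ μ r : ℝ} {β : E n} {x : E n}
    (hx : ‖x - z‖ ≤ r) :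
    |quad z ν α β κ μ x| ≤ |α| + ‖β‖ * r + |κ| * r ^ 2 + |μ| * r ^ 2 ∧
    ‖gradient (quad z ν α β κ μ) x‖ ≤ ‖β‖ + 2 * |κ| * r + 2 * |μ| * r := by
  have hi : ∀ w : E n, |inner ℝ w (x - z)| ≤ ‖w‖ * r := fun w =>
    (abs_real_inner_le_norm _ _).trans (mul_le_mul_of_nonneg_left hx (norm_nonneg _))
  have h1 : |inner ℝ ν (x - z)| ≤ r := by simpa [hν] using hi ν
  have h2 : ‖x - z‖ ^ 2 ≤ r ^ 2 := by gcongr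
  have h3 : (inner ℝ ν (x - z)) ^ 2 ≤ r ^ 2 := by
    rw [← sq_abs]
    gcongr
  constructor
  · unfold quad
    refine (abs_add_le _ _).trans (add_le_add ((abs_add_le _ _).trans (add_le_add
      ((abs_add_le _ _).trans (add_le_add le_rfl (hi β))) ?_)) ?_)
    · rw [abs_mul, abs_of_nonneg (sq_nonneg ‖x - z‖)]
      gcongr
    · rw [abs_mul, abs_of_nonneg (sq_nonneg (inner ℝ ν (x - z)))]
      gcongr
  · rw [gradient_quad]
    refine (norm_add_le _ _).trans (add_le_add ((norm_add_le _ _).trans (add_le_add le_rfl ?_)) ?_)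
    · rw [norm_smul, Real.norm_eq_abs, abs_mul, abs_two]
      gcongr
    · rw [norm_smul, Real.norm_eq_abs, hν, mul_one, abs_mul, abs_mul, abs_two]
      gcongr

/-! ### The reflected supersolution and quadratic strict subsolutions -/

namespace Problem

variable [NeZero n] {F : Jet n → ℝ} {u : E n → ℝ}

theorem contDiffAt (hP : Problem F u) {x : E n} (hx : x ∈ puncturedBall n) :
    ContDiffAt ℝ 2 u x :=
  hP.contDiffOn.contDiffAt (puncturedClosedBall_mem_nhds hx)

theorem contDiffAt_refl (hP : Problem F u) {l : ℝ} {x : E n} (hx : refl l x ∈ puncturedBall n) :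
    ContDiffAt ℝ 2 (fun y => u (refl l y)) x :=
  (hP.contDiffAt hx).comp x (contDiff_refl l).contDiffAt

theorem refl_mem_puncturedBall {l : ℝ} (hl : 0 ≤ l) {x : E n} (hx : x ∈ ball (0 : E n) 1)
    (hlx : l ≤ x 0) (h0 : refl l x ≠ 0) : refl l x ∈ puncturedBall n :=
  mem_puncturedBall.2 ⟨(norm_refl_le hl hlx).trans_lt (mem_ball_zero_iff.1 hx), h0⟩

theorem jet_comp_refl (hP : Problem F u) {l : ℝ} {x : E n} (hx : refl l x ∈ puncturedBall n) :
    jet (fun y => u (refl l y)) x =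
      (u (refl l x), hatVec (gradient u (refl l x)), hatMat (hessian u (refl l x))) := by
  rw [jet, gradient_comp_refl ((hP.contDiffAt hx).differentiableAt (by norm_num)),
    hessian_comp_refl (hP.contDiffAt hx)]

/-- The reflected function is a supersolution. -/
theorem supersolution (hP : Problem F u) {l : ℝ} (hl : 0 < l) {x : E n}
    (hx : x ∈ ball (0 : E n) 1) (hlx : l < x 0) (h0 : refl l x ≠ 0) :
    F (x, jet (fun y => u (refl l y)) x) ≤ 0 := by
  have hmem := refl_mem_puncturedBall hl.le hx hlx.le h0
  rw [hP.jet_comp_refl hmem]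
  have hx1 : x 0 < 1 :=
    (le_abs_self _).trans_lt ((abs_zero_le_norm x).trans_lt (mem_ball_zero_iff.1 hx))
  -- With `t = 2l - x₁` the requirements read `x₁ + t = 2l > 0` and `t > -1`. The condition is
  -- applied to the hatted jet, since hatting twice is the identity.
  have h := hP.reflection x hx (2 * l - x 0) (by linarith) hx1 (by linarith) (by linarith)
    (by linarith) h0 (u (refl l x)) (hatVec (gradient u (refl l x)))
    (hatMat (hessian u (refl l x)))
  have h1 : ∀ p : E n, hatVec (hatVec p) = p := fun p => by
    have h0 : (hatVec p) 0 = - p 0 := by simp [hatVec, setFirst]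
    rw [hatVec_eq (hatVec p), h0, hatVec_eq]
    module
  have h2 : ∀ M : SymMat n, hatMat (hatMat M) = M := fun M => by
    apply SymMat.toMat_injective
    ext i j
    simp only [hatMat, SymMat.toMat_mk, Matrix.of_apply]
    split_ifs <;> simp
  rw [h1, h2] at h
  exact h.trans (hP.eqn _ hmem).le

/-- A large multiple of `ν νᵀ` in the Hessian outweighs every other term of the linearised operator.
The shift `-c` is needed because `F` need not be monotone in `s`, and a contact may occur at a
negative value. The vector `A` later produces the cone at the singularity. -/
theorem barrier (hP : Problem F u) {z ν : E n} (hz : z ∈ puncturedBall n) (hν : ‖ν‖ = 1) {ρ : ℝ}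
    (hρ : 0 < ρ) :
    ∃ K > 0, ∃ r₀ > 0, r₀ ≤ 1 / 4 ∧ K * r₀ ≤ 1 ∧ r₀ ≤ ρ ∧ closedBall z r₀ ⊆ puncturedBall n ∧
      ∃ δ₀ > 0, ∀ x ∈ closedBall z r₀, ∀ δ : ℝ, 0 < δ → δ ≤ δ₀ → ∀ A : E n, ‖A‖ ≤ δ →
        ∀ c : ℝ, 0 ≤ c → c ≤ δ →
        0 < F (x, jet u x + jet (quad z ν (-c) (A - δ • ν) (-(δ / ρ)) (δ * K)) x) := by
  obtain ⟨r₁, hr₁, hr₁s⟩ := nhds_basis_closedBall.mem_iff.1 (isOpen_puncturedBall.mem_nhds hz)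
  obtain ⟨R, hR, hRb⟩ := exists_jet_bound hP.contDiffOn (isCompact_closedBall z r₁)
    (hr₁s.trans puncturedBall_subset)
  have hν0 : ν ≠ 0 := by
    rintro rfl
    simp at hν
  obtain ⟨C, hC, c₀, hc₀, hb⟩ := exists_opDeriv_bounds hP.smooth hP.elliptic
    ((isCompact_closedBall z r₁).prod (isCompact_closedBall (0 : ℝ × E n × SymMat n) (R + 1)))
    (prod_mono (hr₁s.trans puncturedBall_subset) (subset_univ _)) hν0
  -- The value, the gradient and the identity part of the Hessian of `q` have size at most `δ (6 + 2
  -- / ρ)`. This bound is independent of `K` because `K r₀ ≤ 1`. The rank one part contributes at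
  -- least `2 δ K c₀`, which is twice the resulting loss.
  set K := C * (6 + 2 / ρ) / c₀ with hK
  have hK0 : 0 < K := by positivity
  set r₀ := min (min r₁ (1 / 4)) (min (1 / K) ρ) with hr₀
  have hr₀1 : r₀ ≤ r₁ := (min_le_left _ _).trans (min_le_left _ _)
  have hr₀2 : r₀ ≤ 1 / 4 := (min_le_left _ _).trans (min_le_right _ _)
  have hr₀3 : r₀ ≤ 1 / K := (min_le_right _ _).trans (min_le_left _ _)
  have hr₀4 : r₀ ≤ ρ := (min_le_right _ _).trans (min_le_right _ _)
  have hr₀0 : 0 < r₀ := by positivity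
  have hKr : K * r₀ ≤ 1 := by
    rw [mul_comm]
    exact (le_div_iff₀ hK0).1 hr₀3
  -- For `δ ≤ 1 / D` the jet of `q` has norm at most `1`, so the mean value segment stays in the
  -- ball of radius `R + 1`.
  set D := 6 + (2 / ρ + 2 * K) with hD
  have hD0 : 0 < D := by positivity
  refine ⟨K, hK0, r₀, hr₀0, hr₀2, hKr, hr₀4, (closedBall_subset_closedBall hr₀1).trans hr₁s,
    1 / D, by positivity, fun x hx δ hδ hδ₀ A hA c hc hcδ => ?_⟩
  have hδD : δ * D ≤ 1 := (le_div_iff₀ hD0).1 hδ₀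
  set q := quad z ν (-c) (A - δ • ν) (-(δ / ρ)) (δ * K) with hq
  have hxz : ‖x - z‖ ≤ r₀ := by rwa [← dist_eq_norm]
  have hβ : ‖A - δ • ν‖ ≤ 2 * δ := by
    refine (norm_sub_le _ _).trans ?_
    rw [norm_smul, hν, Real.norm_eq_abs, abs_of_pos hδ]
    linarith
  have hrρ : r₀ / ρ ≤ 1 := (div_le_one hρ).2 hr₀4
  obtain ⟨q1, q2⟩ := norm_quad_jet_le (α := -c) (β := A - δ • ν) (κ := -(δ / ρ)) (μ := δ * K) hν hxz
  rw [← hq, abs_neg, abs_neg, abs_of_nonneg hc, abs_of_pos (div_pos hδ hρ),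
    abs_of_pos (mul_pos hδ hK0)] at q1
  rw [← hq, abs_neg, abs_of_pos (div_pos hδ hρ), abs_of_pos (mul_pos hδ hK0)] at q2
  have e1 : δ / ρ * r₀ ≤ δ := by
    calc δ / ρ * r₀ = δ * (r₀ / ρ) := by ring
      _ ≤ δ * 1 := by gcongr
      _ = δ := mul_one _
  have e2 : δ * K * r₀ ≤ δ := by
    calc δ * K * r₀ = δ * (K * r₀) := by ring
      _ ≤ δ * 1 := by gcongr
      _ = δ := mul_one _
  have q1' : |q x| ≤ 6 * δ := by
    have a1 : ‖A - δ • ν‖ * r₀ ≤ 2 * δ * 1 := by gcongr; linarith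
    have a2 : δ / ρ * r₀ ^ 2 ≤ δ * 1 := by
      calc δ / ρ * r₀ ^ 2 = (δ / ρ * r₀) * r₀ := by ring
        _ ≤ δ * 1 := by gcongr; linarith
    have a3 : δ * K * r₀ ^ 2 ≤ δ * 1 := by
      calc δ * K * r₀ ^ 2 = (δ * K * r₀) * r₀ := by ring
        _ ≤ δ * 1 := by gcongr; linarith
    linarith
  have q2' : ‖gradient q x‖ ≤ 6 * δ := by linarith
  have q3 : hessian q x = (-(2 * δ / ρ)) • idMat n + (2 * δ * K) • rankOne ν := by
    rw [hq, hessian_quad]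
    congr 2 <;> ring
  have q4 : ‖(-(2 * δ / ρ)) • idMat n‖ ≤ δ * (2 / ρ) := by
    rw [norm_smul, norm_neg, Real.norm_eq_abs, abs_of_pos (by positivity)]
    calc 2 * δ / ρ * ‖idMat n‖ ≤ 2 * δ / ρ * 1 := by gcongr; exact norm_idMat_le
      _ = δ * (2 / ρ) := by ring
  have q5 : ‖hessian q x‖ ≤ δ * (2 / ρ + 2 * K) := by
    rw [q3]
    refine (norm_add_le _ _).trans ?_
    have : ‖(2 * δ * K) • rankOne ν‖ ≤ 2 * δ * K * 1 := by
      rw [norm_smul, Real.norm_eq_abs, abs_of_pos (by positivity)]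
      gcongr
      exact norm_rankOne_le hν
    linarith
  have hqj : ‖jet q x‖ ≤ 1 := by
    have h6 : 0 ≤ δ * (2 / ρ + 2 * K) := by positivity
    have hδD' : 6 * δ + δ * (2 / ρ + 2 * K) ≤ 1 := by rw [hD] at hδD; linarith
    simp only [jet, Prod.norm_mk, max_le_iff, Real.norm_eq_abs]
    exact ⟨by linarith, by linarith, by linarith⟩
  have hx₁ : x ∈ closedBall z r₁ := closedBall_subset_closedBall hr₀1 hx
  have hxp : x ∈ puncturedBall n := hr₁s hx₁
  have hju := hRb x hx₁ hxp
  obtain ⟨j, hj, hmvt⟩ := exists_jet_mvt hP.smooth (puncturedBall_subset hxp) (jet u x)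
    (jet u x + jet q x)
  have hjm : j ∈ closedBall (0 : ℝ × E n × SymMat n) (R + 1) := by
    refine (convex_closedBall _ _).segment_subset ?_ ?_ hj
    · rw [mem_closedBall_zero_iff]; linarith
    · rw [mem_closedBall_zero_iff]; exact (norm_add_le _ _).trans (by linarith)
  obtain ⟨hb1, hb2⟩ := hb (x, j) ⟨hx₁, hjm⟩
  rw [hP.eqn x hxp, add_sub_cancel_left, sub_zero] at hmvt
  rw [hmvt]
  have hsplit : ((0 : E n), jet q x) = (0, q x, gradient q x, (-(2 * δ / ρ)) • idMat n) +
      (2 * δ * K) • ((0 : E n), (0 : ℝ), (0 : E n), rankOne ν) := by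
    simp [jet, q3]
  rw [hsplit, map_add, map_smul, smul_eq_mul]
  have hn : ‖((0 : E n), q x, gradient q x, (-(2 * δ / ρ)) • idMat n)‖ ≤ δ * (6 + 2 / ρ) := by
    have h6 : 0 ≤ δ * (2 / ρ) := by positivity
    simp only [Prod.norm_mk, max_le_iff, Real.norm_eq_abs, norm_zero]
    exact ⟨by positivity, by linarith, by linarith, by linarith⟩
  have h7 := (abs_le.1 (hb1 (0, q x, gradient q x, (-(2 * δ / ρ)) • idMat n))).1
  have h8 : C * ‖((0 : E n), q x, gradient q x, (-(2 * δ / ρ)) • idMat n)‖ ≤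
      C * (δ * (6 + 2 / ρ)) := by gcongr
  have h9 : 2 * δ * K * c₀ ≤ 2 * δ * K * opDeriv F (x, j) (0, 0, 0, rankOne ν) := by gcongr
  have h10 : K * c₀ = C * (6 + 2 / ρ) := by
    rw [hK]
    field_simp
  have h11 : 0 < δ * (C * (6 + 2 / ρ)) := by positivity
  have h12 : 2 * δ * K * c₀ = 2 * (δ * (C * (6 + 2 / ρ))) := by
    rw [← h10]; ring
  linarith

end Problem

/-! ### The Hopf barrier -/

/-- The quadratic barrier, positive only inside the ball of radius `ρ` about `z - ρ ν`
on small spheres about `z`. -/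
noncomputable def hopfBarrier (z ν : E n) (ρ K : ℝ) (x : E n) : ℝ :=
  quad z ν 0 (-ν) (-(1 / ρ)) K x

theorem quad_eq_hopfBarrier (z ν A : E n) (c ρ K δ : ℝ) (x : E n) :
    quad z ν (-c) (A - δ • ν) (-(δ / ρ)) (δ * K) x =
      -c + inner ℝ A (x - z) + δ * hopfBarrier z ν ρ K x := by
  simp only [hopfBarrier, quad, inner_sub_left A, inner_neg_left, inner_smul_left]
  simp
  ring

/-- With `t = ⟨ν, x - z⟩` the barrier is `-t - r² / ρ + K t²`, and lying outside the ball means `t >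
-r² / (2ρ)`. If `t ≥ 0`, then `K t² ≤ t`. If `t < 0`, then `K t² ≤ -t / 2`, and `-3t / 2 < r² / ρ`.
-/
theorem hopfBarrier_neg {z ν : E n} {ρ K r : ℝ} (hν : ‖ν‖ = 1) (hρ : 0 < ρ) (hK : 0 < K)
    (hr : 0 < r) (hKr : K * r ≤ 1) (hrρ : r ≤ ρ) {x : E n} (hx : ‖x - z‖ = r)
    (hxb : x ∉ closedBall (z - ρ • ν) ρ) : hopfBarrier z ν ρ K x < 0 := by
  have h1 : ρ < ‖(x - z) + ρ • ν‖ := by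
    rwa [mem_closedBall, not_le, dist_eq_norm,
      show x - (z - ρ • ν) = (x - z) + ρ • ν by abel] at hxb
  have h2 : ρ ^ 2 < ‖(x - z) + ρ • ν‖ ^ 2 := by gcongr
  rw [norm_add_sq_real, hx, norm_smul, hν, inner_smul_right, real_inner_comm, Real.norm_eq_abs,
    abs_of_pos hρ] at h2
  have h3 : |inner ℝ ν (x - z)| ≤ r := by
    simpa [hν, hx] using abs_real_inner_le_norm ν (x - z)
  simp only [hopfBarrier, quad, inner_neg_left, hx]
  set t : ℝ := inner ℝ ν (x - z)
  have h4 : -(r ^ 2 / (2 * ρ)) < t := by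
    rw [neg_lt, div_eq_mul_inv, ← div_eq_mul_inv, lt_div_iff₀ (by positivity)]
    nlinarith
  have h5 : r ^ 2 / (2 * ρ) ≤ r / 2 := by
    rw [div_le_div_iff₀ (by positivity) (by positivity)]
    nlinarith
  have h6 : 0 < r ^ 2 / (2 * ρ) := by positivity
  have h7 : 1 / ρ * r ^ 2 = 2 * (r ^ 2 / (2 * ρ)) := by field_simp
  have h8 := abs_le.1 h3
  rw [show -(1 / ρ) * r ^ 2 = -(1 / ρ * r ^ 2) by ring, h7]
  rcases le_or_gt 0 t with ht | ht
  · have : K * t ^ 2 ≤ t := by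
      have : K * t ≤ 1 := le_trans (by gcongr; exact h8.2) hKr
      nlinarith
    linarith
  · have : K * t ^ 2 ≤ -t * (1 / 2) := by
      have : K * (-t) ≤ 1 / 2 := by
        have : K * (-t) ≤ K * (r / 2) := by gcongr; linarith
        linarith
      nlinarith
    linarith

theorem abs_hopfBarrier_le {z ν : E n} {ρ K r : ℝ} (hν : ‖ν‖ = 1) (hρ : 0 < ρ) (hK : 0 < K)
    (hr : 0 < r) (hKr : K * r ≤ 1) (hrρ : r ≤ ρ) (hr4 : r ≤ 1 / 4) {x : E n} (hx : ‖x - z‖ ≤ r) :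
    |hopfBarrier z ν ρ K x| ≤ 3 / 4 := by
  have h := (norm_quad_jet_le (α := 0) (β := -ν) (κ := -(1 / ρ)) (μ := K) hν hx).1
  rw [norm_neg, hν, abs_neg, abs_of_pos (one_div_pos.2 hρ), abs_of_pos hK, abs_zero] at h
  have h1 : 1 / ρ * r ^ 2 ≤ 1 * r := by
    calc 1 / ρ * r ^ 2 = (r / ρ) * r := by ring
      _ ≤ 1 * r := by gcongr; exact (div_le_one hρ).2 hrρ
  have h2 : K * r ^ 2 ≤ 1 * r := by
    calc K * r ^ 2 = (K * r) * r := by ring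
      _ ≤ 1 * r := by gcongr
  exact h.trans (by linarith)

/-- Outside the touching ball the barrier is negative and `w ≥ 0` suffices. Inside it `w` has a
positive minimum by compactness, which a small `δ` respects. -/
theorem exists_smul_hopfBarrier_lt {z ν : E n} {ρ K r δ₀ : ℝ} (hν : ‖ν‖ = 1) (hρ : 0 < ρ)
    (hK : 0 < K) (hr : 0 < r) (hKr : K * r ≤ 1) (hrρ : r ≤ ρ) (hr4 : r ≤ 1 / 4) (hδ₀ : 0 < δ₀)
    {S : Set (E n)} (hS : IsCompact S) (hSr : S ⊆ sphere z r) {w : E n → ℝ}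
    (hwc : ContinuousOn w S) (hw : ∀ x ∈ S, 0 ≤ w x)
    (hwpos : ∀ x ∈ S, x ∈ closedBall (z - ρ • ν) ρ → 0 < w x) :
    ∃ δ > 0, δ ≤ δ₀ ∧ ∀ x ∈ S, 0 < w x - δ * hopfBarrier z ν ρ K x := by
  have hS' : IsCompact (S ∩ closedBall (z - ρ • ν) ρ) := hS.inter_right isClosed_closedBall
  obtain ⟨m, hm, hmb⟩ := hS'.exists_forall_le' (hwc.mono inter_subset_left) (a := 0)
    fun x hx => hwpos x hx.1 hx.2
  have hmin : 0 < min δ₀ m := lt_min hδ₀ hm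
  refine ⟨min δ₀ m, hmin, min_le_left _ _, fun x hx => ?_⟩
  have hxr : ‖x - z‖ = r := by rw [← dist_eq_norm]; exact hSr hx
  by_cases hxb : x ∈ closedBall (z - ρ • ν) ρ
  · have h1 := hmb x ⟨hx, hxb⟩
    have h2 := (abs_le.1 (abs_hopfBarrier_le hν hρ hK hr hKr hrρ hr4 hxr.le)).2
    have h3 : min δ₀ m * hopfBarrier z ν ρ K x ≤ m * (3 / 4) := by
      calc min δ₀ m * hopfBarrier z ν ρ K x ≤ min δ₀ m * (3 / 4) := by gcongr
        _ ≤ m * (3 / 4) := by gcongr; exact min_le_right _ _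
    linarith
  · have h1 := hopfBarrier_neg hν hρ hK hr hKr hrρ hxr hxb
    have h3 := mul_neg_of_pos_of_neg hmin h1
    linarith [hw x hx]

theorem continuous_hopfBarrier (z ν : E n) (ρ K : ℝ) : Continuous (hopfBarrier z ν ρ K) :=
  (contDiff_quad (m := 0) _ _ _ _ _ _).continuous

@[simp] theorem hopfBarrier_self (z ν : E n) (ρ K : ℝ) : hopfBarrier z ν ρ K z = 0 := by
  simp [hopfBarrier, quad]

/-! ### Comparison with the barrier on punctured sets -/

namespace Problem

variable [NeZero n] {F : Jet n → ℝ} {u : E n → ℝ}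

/-- A strict subsolution cannot touch the reflected function from below. -/
theorem not_isLocalMin (hP : Problem F u) {l : ℝ} (hl : 0 < l) {x : E n}
    (hx : x ∈ ball (0 : E n) 1) (hlx : l < x 0) (h0 : refl l x ≠ 0) {q : E n → ℝ}
    (hq : ContDiff ℝ 2 q) (hval : u (refl l x) = u x + q x)
    (hpos : 0 < F (x, jet u x + jet q x)) :
    ¬ IsLocalMin (fun y => u (refl l y) - u y - q y) x := by
  intro hmin
  have hmem := refl_mem_puncturedBall hl.le hx hlx.le h0
  have hxp : x ∈ puncturedBall n := by
    refine ⟨hx, ?_⟩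
    rintro rfl
    simp at hlx
    linarith
  obtain ⟨hg, hH⟩ := jet_of_isLocalMin (hP.contDiffAt_refl hmem) (hP.contDiffAt hxp)
    hq.contDiffAt hmin
  have h1 := hP.supersolution hl hx hlx h0
  have h2 := le_of_posSemidef hP.smooth hP.elliptic (puncturedBall_subset hxp) (u x + q x)
    (gradient u x + gradient q x) hH
  simp only [jet] at h1 hpos
  rw [hval, hg] at h1
  exact absurd (hpos.trans_le h2) (not_lt.2 h1)

theorem continuousOn_u (hP : Problem F u) : ContinuousOn u (puncturedClosedBall n) :=
  hP.contDiffOn.continuousOn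

/-- Comparison with the barrier on a compact set, possibly punctured at the centre. -/
theorem barrier_le (hP : Problem F u) {l : ℝ} (hl : 0 < l) {z ν : E n} (hν : ‖ν‖ = 1)
    {ρ K r₀ δ : ℝ} (hρ : 0 < ρ) (hK : 0 < K) (hr₀ : 0 < r₀) (hr4 : r₀ ≤ 1 / 4) (hKr : K * r₀ ≤ 1)
    (hrρ : r₀ ≤ ρ) (hzr : closedBall z r₀ ⊆ puncturedBall n) {A : E n} (hA : ‖A‖ ≤ δ)
    (hδ : 0 < δ)
    (hbar : ∀ x ∈ closedBall z r₀, ∀ c : ℝ, 0 ≤ c → c ≤ δ →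
        0 < F (x, jet u x + jet (quad z ν (-c) (A - δ • ν) (-(δ / ρ)) (δ * K)) x))
    {Q : Set (E n)} (hQ : IsCompact Q) (hQr : Q ⊆ closedBall z r₀)
    (hQ0 : ∀ x ∈ Q, x ≠ z → refl l x ≠ 0 ∧ l ≤ x 0 ∧ u x ≤ u (refl l x))
    (hQb : ∀ x ∈ Q, x ≠ z →
      inner ℝ A (x - z) + δ * hopfBarrier z ν ρ K x ≤ u (refl l x) - u x ∨ (Q ∈ 𝓝 x ∧ l < x 0)) :
    ∀ x ∈ Q, x ≠ z →
      inner ℝ A (x - z) + δ * hopfBarrier z ν ρ K x ≤ u (refl l x) - u x := by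
  intro y hy hyz
  by_contra! hlt
  set b : E n → ℝ := fun x => inner ℝ A (x - z) + δ * hopfBarrier z ν ρ K x with hb
  have hbc : Continuous b := by
    have := continuous_hopfBarrier z ν ρ K
    fun_prop
  set W : E n → ℝ := fun x => u (refl l x) - u x - b x with hW
  have hWy : W y < 0 := by simp only [hW, hb]; linarith
  have hbz : b z = 0 := by simp [hb]
  -- Nothing is known about `W` at `z`. Off `z` one has `W ≥ -b`, and `b z = 0`, so `W > W y` on a
  -- small punctured ball. Minimising outside that ball therefore gives the minimum over all of `Q \
  -- {z}`.
  obtain ⟨s, hs, hsb⟩ := Metric.eventually_nhds_iff_ball.1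
    (hbc.continuousAt.eventually (gt_mem_nhds (show b z < -W y by rw [hbz]; linarith)))
  have hmem : ∀ x ∈ Q, x ≠ z → refl l x ∈ puncturedBall n := fun x hx hxz =>
    refl_mem_puncturedBall hl.le (hzr (hQr hx)).1 (hQ0 x hx hxz).2.1 (hQ0 x hx hxz).1
  have hsW : ∀ x ∈ Q, x ≠ z → x ∈ ball z s → W y < W x := fun x hx hxz hxs => by
    have h1 := hsb x hxs
    have h2 := (hQ0 x hx hxz).2.2
    simp only [hW] at h1 ⊢
    linarith
  have hne : ∀ x ∈ Q \ ball z s, x ≠ z := by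
    rintro x hx rfl
    exact hx.2 (mem_ball_self hs)
  have hQc : IsCompact (Q \ ball z s) := hQ.diff isOpen_ball
  have hWc : ContinuousOn W (Q \ ball z s) := by
    refine ContinuousOn.sub (ContinuousOn.sub ?_ ?_) hbc.continuousOn
    · exact hP.continuousOn_u.comp (continuous_refl_right l).continuousOn fun x hx =>
        puncturedBall_subset (hmem x hx.1 (hne x hx))
    · exact hP.continuousOn_u.mono fun x hx => puncturedBall_subset (hzr (hQr hx.1))
  have hyQ : y ∈ Q \ ball z s := ⟨hy, fun h => lt_irrefl _ (hsW y hy hyz h)⟩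
  obtain ⟨x, hx, hmin⟩ := hQc.exists_isMinOn ⟨y, hyQ⟩ hWc
  have hxz := hne x hx
  have hxW : W x < 0 := (hmin hyQ).trans_lt hWy
  have hglob : ∀ x' ∈ Q, x' ≠ z → W x ≤ W x' := fun x' hx' hxz' => by
    by_cases h : x' ∈ ball z s
    · exact (hmin hyQ).trans (hsW x' hx' hxz' h).le
    · exact hmin ⟨hx', h⟩
  obtain ⟨hn, hlx⟩ : Q ∈ 𝓝 x ∧ l < x 0 := by
    refine (hQb x hx.1 hxz).resolve_left fun h => ?_
    simp only [hW, hb] at hxW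
    linarith
  have hQx := hQ0 x hx.1 hxz
  have hxr : ‖x - z‖ ≤ r₀ := by
    rw [← dist_eq_norm]
    exact hQr hx.1
  -- The depth `-W x` serves as the shift `c`. It is at most `δ / 4 + 3δ / 4`, which is why `r₀ ≤ 1
  -- / 4` is imposed.
  have hWl : -W x ≤ δ := by
    have h1 := (abs_le.1 (abs_hopfBarrier_le hν hρ hK hr₀ hKr hrρ hr4 hxr)).2
    have h2 : inner ℝ A (x - z) ≤ δ * (1 / 4) := (real_inner_le_norm _ _).trans (by
      gcongr
      exact hxr.trans hr4)
    have h3 : δ * hopfBarrier z ν ρ K x ≤ δ * (3 / 4) := by gcongr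
    simp only [hW, hb]
    linarith [hQx.2.2]
  refine hP.not_isLocalMin hl (hzr (hQr hx.1)).1 hlx hQx.1
    (q := quad z ν (-(-W x)) (A - δ • ν) (-(δ / ρ)) (δ * K))
    (contDiff_quad _ _ _ _ _ _) ?_ (hbar x (hQr hx.1) (-W x) (by linarith) hWl) ?_
  · rw [quad_eq_hopfBarrier]
    simp only [hW, hb]
    ring
  · filter_upwards [hn, isOpen_compl_singleton.mem_nhds hxz] with x' hx' hxz'
    have := hglob x' hx' hxz'
    rw [quad_eq_hopfBarrier, quad_eq_hopfBarrier]
    simp only [hW, hb] at this ⊢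
    linarith

end Problem

/-! ### Reflected inequalities, touching balls and superaffine functions -/

theorem continuous_coord (i : Fin n) : Continuous fun x : E n => x i := by fun_prop

section

variable [NeZero n]

/-- The reflected inequality for the hyperplane `x₁ = l`. -/
def ReflLE (u : E n → ℝ) (l : ℝ) : Prop :=
  ∀ x ∈ closedBall (0 : E n) 1, l ≤ x 0 → refl l x ≠ 0 → u x ≤ u (refl l x)

/-- The lower limit of `u` at the reflection of `x` exceeds `u x`. -/
def StrictAt (u : E n → ℝ) (l : ℝ) (x : E n) : Prop :=
  ∃ a > u x, ∀ᶠ y in 𝓝[puncturedClosedBall n] (refl l x), a ≤ u y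

theorem StrictAt.lt {u : E n → ℝ} {l : ℝ} {x : E n} (h : StrictAt u l x)
    (hx : refl l x ∈ puncturedClosedBall n) : u x < u (refl l x) := by
  obtain ⟨a, ha, hev⟩ := h
  exact lt_of_lt_of_le ha (hev.self_of_nhdsWithin hx)

theorem strictAt_of_lt {u : E n → ℝ} {l : ℝ} {x : E n}
    (hu : ContinuousOn u (puncturedClosedBall n))
    (hx : refl l x ∈ puncturedClosedBall n) (h : u x < u (refl l x)) : StrictAt u l x := by
  obtain ⟨a, ha, ha'⟩ := exists_between h
  exact ⟨a, ha, ((hu _ hx).eventually (lt_mem_nhds ha')).mono fun _ h => h.le⟩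

/-- Strictness is open jointly in `l` and `x`: a lower bound for `u` near `refl l x` is also one
near every neighbouring point, and a number between `u x` and the bound absorbs the variation of
`u`. -/
theorem StrictAt.eventually {u : E n → ℝ} {l : ℝ} {x : E n} (h : StrictAt u l x)
    (hu : ContinuousOn u (puncturedClosedBall n)) (hx : x ∈ puncturedClosedBall n) :
    ∀ᶠ p in 𝓝 l ×ˢ 𝓝[puncturedClosedBall n] x, StrictAt u p.1 p.2 := by
  obtain ⟨a, ha, hev⟩ := h
  obtain ⟨b, hb, hba⟩ := exists_between ha
  have h1 : ∀ᶠ p in 𝓝 l ×ˢ 𝓝[puncturedClosedBall n] x, u p.2 < b :=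
    tendsto_snd.eventually ((hu x hx).eventually (gt_mem_nhds hb))
  have h2 : ∀ᶠ y in 𝓝 (refl l x), ∀ᶠ y' in 𝓝[puncturedClosedBall n] y, a ≤ u y' := by
    rw [eventually_nhdsWithin_iff] at hev
    filter_upwards [hev.eventually_nhds] with y hy
    rwa [eventually_nhdsWithin_iff]
  have h3 : Tendsto (fun p : ℝ × E n => refl p.1 p.2) (𝓝 l ×ˢ 𝓝[puncturedClosedBall n] x)
      (𝓝 (refl l x)) :=
    (continuous_refl.tendsto (l, x)).mono_left (by
      rw [nhds_prod_eq]
      exact prod_mono le_rfl nhdsWithin_le_nhds)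
  filter_upwards [h1, h3.eventually h2] with p hp1 hp2
  exact ⟨a, hp1.trans hba, hp2⟩

/-- The open cap cut off from the unit ball by the hyperplane `x₁ = l`. -/
def cap (n : ℕ) [NeZero n] (l : ℝ) : Set (E n) := {x | x ∈ ball (0 : E n) 1 ∧ l < x 0}

theorem isOpen_cap (l : ℝ) : IsOpen (cap n l) :=
  isOpen_ball.inter (isOpen_lt continuous_const (continuous_coord 0))

theorem convex_cap (l : ℝ) : Convex ℝ (cap n l) := by
  exact (convex_ball _ _).inter
    (convex_halfSpace_gt (f := fun x : E n => x 0) ⟨fun _ _ => rfl, fun _ _ => rfl⟩ l)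

theorem cap_subset {l : ℝ} (hl : 0 < l) : cap n l ⊆ puncturedBall n := by
  intro x hx
  refine ⟨hx.1, ?_⟩
  rintro rfl
  have := hx.2
  simp at this
  linarith

end

/-- A proper nonempty relatively open subset of a connected open set admits an interior
touching ball. -/
theorem exists_touching_ball {D O : Set (E n)} (hD : IsOpen D) (hDc : IsPreconnected D)
    (hO : IsOpen O) (hne : (D ∩ O).Nonempty) (hDO : ¬ D ⊆ O) :
    ∃ z ∈ D, z ∉ O ∧ ∃ ν : E n, ‖ν‖ = 1 ∧ ∃ ρ > 0,
      ∀ x ∈ closedBall (z - ρ • ν) ρ, x ≠ z → x ∈ O ∧ x ∈ D := by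
  obtain ⟨b, hbD, hbO, hbc⟩ : ∃ b ∈ D, b ∉ O ∧ b ∈ closure O := by
    by_contra! h
    exact hDO (hDc.subset_of_closure_inter_subset hO hne fun b hb =>
      by_contra fun hbO => h b hb.2 hbO hb.1)
  obtain ⟨r, hr, hrD⟩ := Metric.isOpen_iff.1 hD b hbD
  obtain ⟨o, hoO, hob⟩ := Metric.mem_closure_iff.1 hbc (r / 3) (by positivity)
  have hKc : IsCompact (closedBall b (2 * r / 3) \ O) := (isCompact_closedBall _ _).diff hO
  have hbK : b ∈ closedBall b (2 * r / 3) \ O := ⟨mem_closedBall_self (by positivity), hbO⟩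
  obtain ⟨z, hz, hmin⟩ := hKc.exists_isMinOn ⟨b, hbK⟩
    (f := fun x => dist x o) (by fun_prop)
  have hzo : dist z o < r / 3 := (hmin hbK).trans_lt hob
  have hz0 : 0 < dist z o := by
    rw [dist_pos]
    rintro rfl
    exact hz.2 hoO
  have hball : ∀ x, dist x o < dist z o → x ∈ O ∧ x ∈ D := by
    intro x hx
    have hxb : dist x b < 2 * r / 3 := by
      linarith [dist_triangle x o b, dist_comm o b]
    refine ⟨by_contra fun hxO => ?_, hrD (hxb.trans (by linarith))⟩
    exact absurd (hmin (show x ∈ closedBall b (2 * r / 3) \ O from ⟨hxb.le, hxO⟩)) (not_le.2 hx)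
  have hzD : z ∈ D := hrD (mem_ball.2 (by linarith [mem_closedBall.1 hz.1]))
  set d := dist z o with hd
  have hdn : ‖z - o‖ = d := by rw [hd, dist_eq_norm]
  -- The open ball about `o` of radius `d` lies in `O`. The closed ball of half that radius,
  -- internally tangent at `z`, lies in it except for `z`.
  refine ⟨z, hzD, hz.2, d⁻¹ • (z - o), ?_, d / 2, by positivity, fun x hx hxz => ?_⟩
  · rw [norm_smul, hdn, norm_inv, Real.norm_eq_abs, abs_of_pos hz0, inv_mul_cancel₀ hz0.ne']
  have hcen : z - (d / 2) • d⁻¹ • (z - o) = midpoint ℝ o z := by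
    rw [smul_smul, midpoint_eq_smul_add]
    have : d / 2 * d⁻¹ = 2⁻¹ := by field_simp
    rw [this]
    simp only [invOf_eq_inv]
    module
  rw [hcen, mem_closedBall, dist_eq_norm] at hx
  apply hball
  rw [dist_eq_norm]
  set w := x - midpoint ℝ o z with hw
  have h1 : x - o = w + (2⁻¹ : ℝ) • (z - o) := by
    rw [hw, midpoint_eq_smul_add]
    simp only [invOf_eq_inv]
    module
  have h2 : x - z = w - (2⁻¹ : ℝ) • (z - o) := by
    rw [hw, midpoint_eq_smul_add]
    simp only [invOf_eq_inv]
    module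
  have h3 : 0 < ‖x - z‖ := norm_pos_iff.2 (sub_ne_zero.2 hxz)
  have hpar := parallelogram_law_with_norm ℝ w ((2⁻¹ : ℝ) • (z - o))
  rw [← h1, ← h2, norm_smul, hdn] at hpar
  norm_num at hpar
  by_contra! hge
  nlinarith [norm_nonneg w, mul_self_nonneg (‖x - z‖)]

/-- Superaffine functions which lie above a cone over an affine function have a lower limit
strictly above its value. -/
theorem SuperaffineNearZero.exists_lt {u : E n → ℝ} {R : ℝ} (hR : 0 < R)
    (hu : SuperaffineNearZero u R) {a κ : ℝ} (hκ : 0 < κ) {B : E n}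
    (h : ∀ᶠ y in 𝓝[≠] (0 : E n), a + inner ℝ B y + κ * ‖y‖ ≤ u y) :
    ∃ b > a, ∀ᶠ y in 𝓝[≠] (0 : E n), b ≤ u y := by
  rw [eventually_nhdsWithin_iff] at h
  obtain ⟨s, hs, hsb⟩ := Metric.eventually_nhds_iff_ball.1 h
  set r := min s R / 2 with hr
  have hm : 0 < min s R := lt_min hs hR
  have hr0 : 0 < r := by positivity
  have hrs : r < s := by linarith [min_le_left s R]
  have hrR : r < R := by linarith [min_le_right s R]
  -- Taking `V = -B` cancels the linear part, so the minimum over the sphere is at least `a + κ r`.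
  -- Half of the gain absorbs `⟨B, y⟩` near `0`.
  obtain ⟨m, ⟨⟨y, hy, hym⟩, -⟩, hglb, -⟩ := hu (-B) r hr0 hrR
  have hyr : ‖y‖ = r := mem_sphere_zero_iff_norm.1 hy
  have hy0 : y ≠ 0 := by
    rintro rfl
    simp at hyr
    linarith
  have h1 := hsb y (by rw [mem_ball_zero_iff, hyr]; exact hrs) hy0
  simp only [inner_neg_left] at hym
  rw [hyr] at h1
  refine ⟨a + κ * r / 2, by linarith [mul_pos hκ hr0], ?_⟩
  have hc : Continuous fun y : E n => (inner ℝ B y : ℝ) := by fun_prop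
  have h2 : ∀ᶠ y in 𝓝 (0 : E n), -(κ * r / 2) < inner ℝ B y :=
    hc.continuousAt.eventually (lt_mem_nhds (by simp; positivity))
  filter_upwards [nhdsWithin_le_nhds h2, nhdsWithin_le_nhds (ball_mem_nhds (0 : E n) hr0),
    self_mem_nhdsWithin] with y' hy1 hy2 hy3
  have h3 := hglb ⟨y', ⟨hy2, hy3⟩, rfl⟩
  simp only [inner_neg_left] at h3
  linarith

theorem nhdsWithin_puncturedClosedBall_zero_le : 𝓝[puncturedClosedBall n] (0 : E n) ≤ 𝓝[≠] 0 :=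
  nhdsWithin_mono _ fun _ hx => hx.2

/-! ### Propagation of strictness through a touching point, singular or not -/

namespace Problem

variable [NeZero n] {F : Jet n → ℝ} {u : E n → ℝ}

/-- This is Hopf's argument at the tangency point `z`. If the reflection is regular at `z`, equality
there would contradict the slope of the barrier. If `refl l z = 0`, the free linear term of the
barrier yields a cone, to which the superaffine hypothesis applies. -/
theorem strictAt_of_touching_ball (hP : Problem F u) {l : ℝ} (hl : 0 < l) (hle : ReflLE u l)
    {z ν : E n} {ρ : ℝ} (hz : z ∈ cap n l) (hν : ‖ν‖ = 1) (hρ : 0 < ρ)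
    (hball : ∀ x ∈ closedBall (z - ρ • ν) ρ, x ≠ z → StrictAt u l x) :
    StrictAt u l z := by
  obtain ⟨K, hK, r₀, hr₀, hr4, hKr, hrρ, hzr, δ₀, hδ₀, hbar⟩ :=
    hP.barrier (cap_subset hl hz) hν hρ
  obtain ⟨r, hr, hrr, hrcap, hr0⟩ : ∃ r > 0, r ≤ r₀ ∧ closedBall z r ⊆ cap n l ∧
      ∀ x ∈ closedBall z r, x ≠ z → refl l x ≠ 0 := by
    have h1 : ∀ᶠ x in 𝓝 z, x ∈ cap n l ∧ (x ≠ z → refl l x ≠ 0) := by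
      refine (show ∀ᶠ x in 𝓝 z, x ∈ cap n l from (isOpen_cap l).mem_nhds hz).and ?_
      by_cases h0 : refl l z = 0
      · refine Eventually.of_forall fun x hx hx0 => hx ?_
        rw [← refl_refl l x, hx0, ← h0, refl_refl]
      · exact ((continuous_refl_right l).continuousAt.eventually_ne h0).mono fun x hx _ => hx
    obtain ⟨s, hs, hsb⟩ := nhds_basis_closedBall.mem_iff.1 h1
    refine ⟨min s r₀, lt_min hs hr₀, min_le_right _ _, fun x hx => ?_, fun x hx => ?_⟩
    · exact (hsb (closedBall_subset_closedBall (min_le_left _ _) hx)).1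
    · exact (hsb (closedBall_subset_closedBall (min_le_left _ _) hx)).2
  have hKr' : K * r ≤ 1 := le_trans (by gcongr) hKr
  have hrρ' : r ≤ ρ := hrr.trans hrρ
  have hmem : ∀ x ∈ closedBall z r, x ≠ z → refl l x ∈ puncturedBall n := fun x hx hxz =>
    refl_mem_puncturedBall hl.le (hrcap hx).1 (hrcap hx).2.le (hr0 x hx hxz)
  have hw : ∀ x ∈ closedBall z r, x ≠ z → u x ≤ u (refl l x) := fun x hx hxz =>
    hle x (ball_subset_closedBall (hrcap hx).1) (hrcap hx).2.le (hr0 x hx hxz)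
  have hne : ∀ x ∈ sphere z r, x ≠ z := by
    rintro x hx rfl
    simp at hx
    linarith
  have hwc : ContinuousOn (fun x => u (refl l x) - u x) (sphere z r) := by
    refine ContinuousOn.sub ?_ ?_
    · exact hP.continuousOn_u.comp (continuous_refl_right l).continuousOn fun x hx =>
        puncturedBall_subset (hmem x (sphere_subset_closedBall hx) (hne x hx))
    · exact hP.continuousOn_u.mono fun x hx =>
        puncturedBall_subset (cap_subset hl (hrcap (sphere_subset_closedBall hx)))
  obtain ⟨δ, hδ, hδδ, hδs⟩ := exists_smul_hopfBarrier_lt hν hρ hK hr hKr' hrρ' (hrr.trans hr4)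
    hδ₀ (isCompact_sphere z r) subset_rfl hwc
    (fun x hx => sub_nonneg.2 (hw x (sphere_subset_closedBall hx) (hne x hx)))
    (fun x hx hxb => sub_pos.2 ((hball x hxb (hne x hx)).lt (puncturedBall_subset
      (hmem x (sphere_subset_closedBall hx) (hne x hx)))))
  -- The gap `ε` on the sphere leaves room for any linear term with `‖A‖ ≤ ε`, as `r ≤ 1`.
  obtain ⟨ε, hε, hεb⟩ := (isCompact_sphere z r).exists_forall_le'
    (hwc.sub ((continuous_hopfBarrier z ν ρ K).const_mul δ).continuousOn) (a := 0) hδs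
  have hmain : ∀ A : E n, ‖A‖ ≤ min δ ε → ∀ x ∈ closedBall z r, x ≠ z →
      inner ℝ A (x - z) + δ * hopfBarrier z ν ρ K x ≤ u (refl l x) - u x := by
    intro A hA
    refine hP.barrier_le hl hν hρ hK hr₀ hr4 hKr hrρ hzr (hA.trans (min_le_left _ _)) hδ
      (fun x hx c hc hcδ => hbar x hx δ hδ hδδ A (hA.trans (min_le_left _ _)) c hc hcδ)
      (isCompact_closedBall z r) (closedBall_subset_closedBall hrr)
      (fun x hx hxz => ⟨hr0 x hx hxz, (hrcap hx).2.le, hw x hx hxz⟩) fun x hx hxz => ?_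
    rcases (mem_closedBall.1 hx).lt_or_eq with hlt | heq
    · exact Or.inr ⟨mem_of_superset (isOpen_ball.mem_nhds hlt) ball_subset_closedBall,
        (hrcap hx).2⟩
    · left
      have h1 : ε ≤ u (refl l x) - u x - δ * hopfBarrier z ν ρ K x := hεb x heq
      have h2 : inner ℝ A (x - z) ≤ ε * 1 := by
        refine (real_inner_le_norm _ _).trans ?_
        rw [← dist_eq_norm, heq]
        gcongr
        · exact hA.trans (min_le_right _ _)
        · linarith
      linarith
  by_cases h0 : refl l z = 0
  · -- the singular case
    obtain ⟨R, hR, -, hsup⟩ := hP.superaffine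
    set κ := min δ ε with hκ
    have hκ0 : 0 < κ := lt_min hδ hε
    have hcone : ∀ x ∈ closedBall z r, x ≠ z →
        κ * ‖x - z‖ + δ * hopfBarrier z ν ρ K x ≤ u (refl l x) - u x := by
      intro x hx hxz
      have hn : 0 < ‖x - z‖ := norm_pos_iff.2 (sub_ne_zero.2 hxz)
      -- The vector `A` may depend on the point. Pointing it along `x - z` turns the family of
      -- linear bounds into a cone.
      have := hmain ((κ / ‖x - z‖) • (x - z)) (by
        rw [norm_smul, Real.norm_eq_abs, abs_of_pos (by positivity), div_mul_cancel₀ _ hn.ne'])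
        x hx hxz
      rw [inner_smul_left, real_inner_self_eq_norm_sq] at this
      have h2 : (starRingEnd ℝ) (κ / ‖x - z‖) * ‖x - z‖ ^ 2 = κ * ‖x - z‖ := by
        simp only [conj_trivial]
        field_simp
      rwa [h2] at this
    have hz0 : refl l 0 = z := by rw [← h0, refl_refl]
    -- After reflecting back, the cone bound reads `u y ≥ g y + κ ‖y‖` near `0`. Since `g` is
    -- differentiable at `0`, its linearisation error costs at most half of the slope.
    set g : E n → ℝ := fun y => u (refl l y) + δ * hopfBarrier z ν ρ K (refl l y) with hg
    have hgd : DifferentiableAt ℝ g 0 := by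
      have hr' : DifferentiableAt ℝ (refl l : E n → E n) 0 :=
        (hasFDerivAt_refl l 0).differentiableAt
      refine DifferentiableAt.add (f := fun y => u (refl l y)) ?_ (DifferentiableAt.const_mul
        (a := fun y => hopfBarrier z ν ρ K (refl l y)) ?_ δ)
      · refine DifferentiableAt.comp (g := u) 0 ?_ hr'
        rw [hz0]
        exact (hP.contDiffAt (cap_subset hl hz)).differentiableAt (by norm_num)
      · refine DifferentiableAt.comp (g := hopfBarrier z ν ρ K) 0 ?_ hr'
        exact ((contDiff_quad (m := 1) _ _ _ _ _ _).differentiable (by norm_num)) _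
    have hg0 : g 0 = u z := by simp [hg, hz0]
    have hlin := hgd.hasFDerivAt.isLittleO.bound (half_pos hκ0)
    have hlow : ∀ᶠ y in 𝓝[≠] (0 : E n),
        u z + inner ℝ (gradient g 0) y + κ / 2 * ‖y‖ ≤ u y := by
      filter_upwards [nhdsWithin_le_nhds hlin, nhdsWithin_le_nhds (ball_mem_nhds (0 : E n) hr),
        self_mem_nhdsWithin] with y hy1 hy2 hy3
      have hd : ‖refl l y - z‖ = ‖y‖ := by
        rw [← dist_eq_norm, ← hz0, dist_refl, dist_zero_right]
      have hyz : refl l y ≠ z := by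
        intro h
        rw [h, sub_self, norm_zero] at hd
        exact hy3 (norm_eq_zero.1 hd.symm)
      have h1 := hcone (refl l y) (by
        rw [mem_closedBall, dist_eq_norm, hd]
        exact (mem_ball_zero_iff.1 hy2).le) hyz
      rw [hd, refl_refl] at h1
      rw [sub_zero, hg0, Real.norm_eq_abs] at hy1
      have h2 := (abs_le.1 hy1).1
      rw [inner_gradient]
      simp only [hg] at h2 ⊢
      linarith
    obtain ⟨b, hb, hbe⟩ := hsup.exists_lt hR (half_pos hκ0) hlow
    refine ⟨b, hb, ?_⟩
    rw [h0]
    exact nhdsWithin_puncturedClosedBall_zero_le hbe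
  · -- the regular case
    have hzm : refl l z ∈ puncturedBall n := refl_mem_puncturedBall hl.le hz.1 hz.2.le h0
    refine strictAt_of_lt hP.continuousOn_u (puncturedBall_subset hzm) ?_
    have hzle := hle z (ball_subset_closedBall hz.1) hz.2.le h0
    refine lt_of_le_of_ne hzle fun heq => ?_
    have hn : closedBall z r ∈ 𝓝 z := closedBall_mem_nhds z hr
    have hU := (hP.contDiffAt_refl hzm)
    have hV := hP.contDiffAt (cap_subset hl hz)
    -- Under equality at `z` both `0` and the barrier touch the difference from below there.
    -- Comparing gradients gives `δ • ν = 0`.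
    have h1 : IsLocalMin (fun y => u (refl l y) - u y - 0) z := by
      filter_upwards [hn] with x hx
      by_cases hxz : x = z
      · rw [hxz]
      · have := hw x hx hxz
        linarith
    have h2 : IsLocalMin (fun y => u (refl l y) - u y - quad z ν (-0) (0 - δ • ν) (-(δ / ρ))
        (δ * K) y) z := by
      filter_upwards [hn] with x hx
      by_cases hxz : x = z
      · rw [hxz]
      · have := hmain 0 (by rw [norm_zero]; positivity) x hx hxz
        rw [quad_eq_hopfBarrier, quad_eq_hopfBarrier, hopfBarrier_self]
        simp only [inner_zero_left, sub_self] at this ⊢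
        linarith
    have e1 := (jet_of_isLocalMin hU hV contDiffAt_const h1).1
    have e2 := (jet_of_isLocalMin hU hV (contDiff_quad _ _ _ _ _ _).contDiffAt h2).1
    rw [e1, gradient_quad] at e2
    simp at e2
    rcases e2 with h | h
    · exact hδ.ne' h
    · simp [h] at hν

end Problem

/-! ### Strict inequality in caps, and narrow strips -/

namespace Problem

variable [NeZero n] {F : Jet n → ℝ} {u : E n → ℝ}

/-- The superaffine hypothesis with `V = 0` bounds `u` near `0` below by its minimum over a sphere,
which is positive. -/
theorem exists_pos_le_near_zero (hP : Problem F u) :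
    ∃ a > 0, ∀ᶠ y in 𝓝[≠] (0 : E n), a ≤ u y := by
  obtain ⟨R, hR, hR1, hsup⟩ := hP.superaffine
  obtain ⟨m, ⟨⟨y, hy, hym⟩, -⟩, hglb, -⟩ := hsup 0 (R / 2) (half_pos hR) (half_lt_self hR)
  have hyR : ‖y‖ = R / 2 := mem_sphere_zero_iff_norm.1 hy
  simp only [inner_zero_left, add_zero] at hym hglb
  refine ⟨m, ?_, ?_⟩
  · rw [← hym]
    refine hP.pos y (mem_puncturedBall.2 ⟨by linarith, ?_⟩)
    rintro rfl
    simp at hyR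
    linarith
  · filter_upwards [nhdsWithin_le_nhds (ball_mem_nhds (0 : E n) (half_pos hR)),
      self_mem_nhdsWithin] with y' h1 h2
    exact hglb ⟨y', ⟨h1, h2⟩, rfl⟩

theorem strictAt_sphere (hP : Problem F u) {l : ℝ} (hl : 0 < l) {x : E n}
    (hx : x ∈ sphere (0 : E n) 1) (hlx : l < x 0) : StrictAt u l x := by
  have hu := hP.bdry x hx
  by_cases h0 : refl l x = 0
  · obtain ⟨a, ha, hev⟩ := hP.exists_pos_le_near_zero
    refine ⟨a, by rwa [hu], ?_⟩
    rw [h0]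
    exact nhdsWithin_puncturedClosedBall_zero_le hev
  · have hmem : refl l x ∈ puncturedBall n := mem_puncturedBall.2
      ⟨(norm_refl_lt hl hlx).trans_eq (mem_sphere_zero_iff_norm.1 hx), h0⟩
    refine strictAt_of_lt hP.continuousOn_u (puncturedBall_subset hmem) ?_
    rw [hu]
    exact hP.pos _ hmem

theorem isOpen_strictAt (hP : Problem F u) {l : ℝ} (hl : 0 < l) :
    IsOpen {x | x ∈ cap n l ∧ StrictAt u l x} := by
  rw [isOpen_iff_mem_nhds]
  rintro x ⟨hx, hs⟩
  have h := hs.eventually hP.continuousOn_u (puncturedBall_subset (cap_subset hl hx))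
  rw [nhdsWithin_eq_nhds.2 (puncturedClosedBall_mem_nhds (cap_subset hl hx))] at h
  have h2 : Tendsto (fun y : E n => (l, y)) (𝓝 x) (𝓝 l ×ˢ 𝓝 x) :=
    tendsto_const_nhds.prodMk tendsto_id
  filter_upwards [(isOpen_cap l).mem_nhds hx, h2.eventually h] with y h3 h4
  exact ⟨h3, h4⟩

/-- Strictness at the boundary point `e₁` spreads to nearby points of the cap. This starts the
connectedness argument. -/
theorem exists_strictAt (hP : Problem F u) {l : ℝ} (hl : 0 < l) (hl1 : l < 1) :
    ∃ x ∈ cap n l, StrictAt u l x := by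
  have he : (e₁ : E n) ∈ sphere (0 : E n) 1 := by simp
  have hep : (e₁ : E n) ∈ puncturedClosedBall n :=
    mem_puncturedClosedBall.2 ⟨by simp, e₁_ne_zero⟩
  have hs := (hP.strictAt_sphere hl he (by simpa using hl1)).eventually hP.continuousOn_u hep
  have hcap : ∀ᶠ t in 𝓝[<] (1 : ℝ), t • (e₁ : E n) ∈ cap n l := by
    filter_upwards [nhdsWithin_le_nhds (lt_mem_nhds hl1), self_mem_nhdsWithin] with t h1 h2
    refine ⟨?_, ?_⟩
    · rw [mem_ball_zero_iff, norm_smul, norm_e₁, mul_one, Real.norm_eq_abs,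
        abs_of_pos (hl.trans h1)]
      exact h2
    · simpa using h1
  have ht : Tendsto (fun t : ℝ => (l, t • (e₁ : E n))) (𝓝[<] 1)
      (𝓝 l ×ˢ 𝓝[puncturedClosedBall n] e₁) := by
    refine tendsto_const_nhds.prodMk (tendsto_nhdsWithin_iff.2 ⟨?_, ?_⟩)
    · have : Continuous fun t : ℝ => t • (e₁ : E n) := by fun_prop
      have := this.tendsto 1
      rw [one_smul] at this
      exact this.mono_left nhdsWithin_le_nhds
    · exact hcap.mono fun t h => puncturedBall_subset (cap_subset hl h)
  obtain ⟨t, h1, h2⟩ := (hcap.and (ht.eventually hs)).exists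
  exact ⟨_, h1, h2⟩

/-- Strong maximum principle in the cap, across the reflected singularity. -/
theorem strictAt_cap (hP : Problem F u) {l : ℝ} (hl : 0 < l) (hl1 : l < 1) (hle : ReflLE u l)
    {x : E n} (hx : x ∈ cap n l) : StrictAt u l x := by
  by_contra hx0
  obtain ⟨y, hy, hys⟩ := hP.exists_strictAt hl hl1
  obtain ⟨z, hz, hzO, ν, hν, ρ, hρ, hb⟩ := exists_touching_ball (isOpen_cap (n := n) l)
    (convex_cap l).isPreconnected (hP.isOpen_strictAt hl) ⟨y, hy, hy, hys⟩
    (fun h => hx0 (h hx).2)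
  exact hzO ⟨hz, hP.strictAt_of_touching_ball hl hle hz hν hρ fun x hx hxz => (hb x hx hxz).1.2⟩

/-- Maximum principle in narrow strips. -/
theorem exists_strip_width (hP : Problem F u) {l₀ : ℝ} (hl₀ : 0 < l₀) :
    ∃ η > 0, ∀ l, l₀ ≤ l →
      (∀ x ∈ closedBall (0 : E n) 1, l + η ≤ x 0 → refl l x ≠ 0 → u x ≤ u (refl l x)) →
      ReflLE u l := by
  set K : Set (E n) := closedBall 0 1 ∩ {x | l₀ / 2 ≤ x 0} with hK
  have hKc : IsCompact K := (isCompact_closedBall _ _).inter_right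
    (isClosed_le continuous_const (continuous_coord 0))
  have hne : ∀ x : E n, 0 < x 0 → x ≠ 0 := by
    rintro x hx rfl
    simp at hx
  have hKs : K ⊆ puncturedClosedBall n := fun x hx =>
    ⟨hx.1, hne x (lt_of_lt_of_le (half_pos hl₀) hx.2)⟩
  obtain ⟨R, hR, hRb⟩ := exists_jet_bound hP.contDiffOn hKc hKs
  obtain ⟨C, hC, c₀, hc₀, hb⟩ := exists_opDeriv_bounds hP.smooth hP.elliptic
    (hKc.prod (isCompact_closedBall (0 : ℝ × E n × SymMat n) R))
    (prod_mono hKs (subset_univ _)) e₁_ne_zero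
  -- The bound `l₀ / 2` keeps the strip and its reflection inside `K`, away from the singularity and
  -- independently of `l`. The bound `c₀ / (2C)` lets the second-order term of the test function
  -- beat the lower-order ones.
  set η := min (min 1 (l₀ / 2)) (c₀ / (2 * C)) with hη
  have hη0 : 0 < η := by positivity
  have hη1 : η ≤ 1 := (min_le_left _ _).trans (min_le_left _ _)
  have hη2 : η ≤ l₀ / 2 := (min_le_left _ _).trans (min_le_right _ _)
  have hη3 : C * η ≤ c₀ / 2 := by
    have : η ≤ c₀ / (2 * C) := min_le_right _ _
    calc C * η ≤ C * (c₀ / (2 * C)) := by gcongr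
      _ = c₀ / 2 := by field_simp
  refine ⟨η, hη0, fun l hl hfar => ?_⟩
  have hl0 : 0 < l := hl₀.trans_le hl
  by_contra hcon
  simp only [ReflLE, not_forall, not_le] at hcon
  obtain ⟨y, hy, hly, hy0, hlt⟩ := hcon
  set Q : Set (E n) := closedBall 0 1 ∩ {x | l ≤ x 0} ∩ {x | x 0 ≤ l + η} with hQ
  have hQc : IsCompact Q := ((isCompact_closedBall _ _).inter_right
    (isClosed_le continuous_const (continuous_coord 0))).inter_right
    (isClosed_le (continuous_coord 0) continuous_const)
  have hQK : ∀ x ∈ Q, x ∈ K ∧ refl l x ∈ K := by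
    rintro x ⟨⟨h1, h2⟩, h3⟩
    simp only [mem_ofPred_eq] at h2 h3
    rw [mem_closedBall_zero_iff] at h1
    refine ⟨⟨by simpa using h1, ?_⟩, ⟨?_, ?_⟩⟩
    · simp only [mem_ofPred_eq]; linarith
    · simpa using (norm_refl_le hl0.le h2).trans h1
    · simp only [mem_ofPred_eq, refl_zero]; linarith
  have hyQ : y ∈ Q := by
    refine ⟨⟨hy, hly⟩, ?_⟩
    by_contra h
    simp only [mem_ofPred_eq, not_le] at h
    exact absurd (hfar y hy h.le hy0) (not_le.2 hlt)
  -- This function is positive and concave across the strip. Minimising `w / g` instead of `w` makes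
  -- `-m g` touch `w` from below, with a strictly positive second derivative `2m` in the direction
  -- `e₁`.
  set g : E n → ℝ := fun x => 2 * η ^ 2 - (x 0 - l) ^ 2 with hg
  have hgc : Continuous g := by
    have := continuous_coord (n := n) 0
    fun_prop
  have hgb : ∀ x ∈ Q, η ^ 2 ≤ g x := by
    rintro x ⟨⟨-, h2⟩, h3⟩
    simp only [mem_ofPred_eq] at h2 h3
    simp only [hg]
    nlinarith
  have hgpos : ∀ x ∈ Q, 0 < g x := fun x hx => (by positivity : 0 < η ^ 2).trans_le (hgb x hx)
  have hwc : ContinuousOn (fun x => (u (refl l x) - u x) / g x) Q := by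
    refine ContinuousOn.div (ContinuousOn.sub ?_ ?_) hgc.continuousOn fun x hx => (hgpos x hx).ne'
    · exact hP.continuousOn_u.comp (continuous_refl_right l).continuousOn fun x hx =>
        hKs (hQK x hx).2
    · exact hP.continuousOn_u.mono fun x hx => hKs (hQK x hx).1
  obtain ⟨x, hx, hmin⟩ := hQc.exists_isMinOn ⟨y, hyQ⟩ hwc
  set m := -((u (refl l x) - u x) / g x) with hm
  have hm0 : 0 < m := by
    have h1 : (u (refl l x) - u x) / g x ≤ (u (refl l y) - u y) / g y := hmin hyQ
    have h2 : (u (refl l y) - u y) / g y < 0 := div_neg_of_neg_of_pos (by linarith) (hgpos y hyQ)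
    rw [hm]
    linarith
  have hxval : u (refl l x) - u x = -m * g x := by
    rw [hm, neg_neg, div_mul_cancel₀ _ (hgpos x hx).ne']
  have hglob : ∀ x' ∈ Q, -m * g x' ≤ u (refl l x') - u x' := fun x' hx' => by
    have h1 : (u (refl l x) - u x) / g x ≤ (u (refl l x') - u x') / g x' := hmin hx'
    rw [hm, neg_neg]
    exact (le_div_iff₀ (hgpos x' hx')).1 h1
  have hxneg : u (refl l x) < u x := by
    have := mul_pos hm0 (hgpos x hx)
    linarith
  obtain ⟨⟨hx1, hx2⟩, hx3⟩ := hx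
  simp only [mem_ofPred_eq] at hx2 hx3
  have hxQ : x ∈ Q := ⟨⟨hx1, hx2⟩, hx3⟩
  have hr0 : refl l x ≠ 0 := (hKs (hQK x hxQ).2).2
  have hlx : l < x 0 := by
    refine lt_of_le_of_ne hx2 fun h => ?_
    rw [refl_eq_self h.symm] at hxneg
    exact lt_irrefl _ hxneg
  have hxl : x 0 < l + η := by
    refine lt_of_le_of_ne hx3 fun h => ?_
    exact absurd (hfar x hx1 h.ge hr0) (not_le.2 hxneg)
  have hxb : x ∈ ball (0 : E n) 1 := by
    rw [mem_ball_zero_iff]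
    refine lt_of_le_of_ne (mem_closedBall_zero_iff.1 hx1) fun h => ?_
    rw [hP.bdry x (mem_sphere_zero_iff_norm.2 h)] at hxneg
    have hmem : refl l x ∈ puncturedBall n :=
      mem_puncturedBall.2 ⟨(norm_refl_lt hl0 hlx).trans_eq h, hr0⟩
    exact absurd (hP.pos _ hmem) (not_lt.2 hxneg.le)
  have hmemU : refl l x ∈ puncturedBall n := refl_mem_puncturedBall hl0.le hxb hx2 hr0
  have hmemV : x ∈ puncturedBall n := ⟨hxb, (hKs (hQK x hxQ).1).2⟩
  have hQn : Q ∈ 𝓝 x := by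
    have ho : IsOpen (ball (0 : E n) 1 ∩ {x | l < x 0} ∩ {x | x 0 < l + η}) :=
      (isOpen_ball.inter (isOpen_lt continuous_const (continuous_coord 0))).inter
        (isOpen_lt (continuous_coord 0) continuous_const)
    refine mem_of_superset (ho.mem_nhds ⟨⟨hxb, hlx⟩, hxl⟩) ?_
    rintro x' ⟨⟨h1, h2⟩, h3⟩
    simp only [mem_ofPred_eq] at h2 h3
    exact ⟨⟨ball_subset_closedBall h1, h2.le⟩, h3.le⟩
  -- the touching function as a quadratic polynomial
  set q := quad (l • (e₁ : E n)) e₁ (-m * (2 * η ^ 2)) 0 0 m with hq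
  have hqg : ∀ x : E n, q x = -m * g x := fun x => by
    have : inner ℝ (e₁ : E n) (x - l • e₁) = x 0 - l := by rw [inner_e₁]; simp
    simp only [hq, quad, hg, this, inner_zero_left]
    ring
  have hlm : IsLocalMin (fun y => u (refl l y) - u y - q y) x := by
    filter_upwards [hQn] with x' hx'
    have := hglob x' hx'
    rw [hqg, hqg]
    linarith
  obtain ⟨hgr, hH⟩ := jet_of_isLocalMin (q := q) (hP.contDiffAt_refl hmemU)
    (hP.contDiffAt hmemV) (contDiff_quad _ _ _ _ _ _).contDiffAt hlm
  have hs := hP.supersolution hl0 hxb hlx hr0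
  obtain ⟨j, hj, hmvt⟩ := exists_jet_mvt hP.smooth (puncturedBall_subset hmemV) (jet u x)
    (jet (fun y => u (refl l y)) x)
  have hRU : ‖jet (fun y => u (refl l y)) x‖ ≤ R := by
    rw [hP.jet_comp_refl hmemU]
    refine le_trans ?_ (hRb _ (hQK x hxQ).2 hmemU)
    simp only [jet, Prod.norm_mk, norm_hatVec]
    gcongr
    exact norm_hatMat_le _
  have hjm : j ∈ closedBall (0 : ℝ × E n × SymMat n) R := by
    refine (convex_closedBall _ _).segment_subset ?_ ?_ hj
    · rw [mem_closedBall_zero_iff]; exact hRb x (hQK x hxQ).1 hmemV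
    · rwa [mem_closedBall_zero_iff]
  obtain ⟨hb1, hb2⟩ := hb (x, j) ⟨(hQK x hxQ).1, hjm⟩
  have hpsd := opDeriv_posSemidef_nonneg hP.smooth hP.elliptic (puncturedBall_subset hmemV) j hH
  rw [hP.eqn x hmemV, sub_zero] at hmvt
  have hqgr : gradient q x = (2 * m * (x 0 - l)) • e₁ := by
    have : inner ℝ (e₁ : E n) (x - l • e₁) = x 0 - l := by rw [inner_e₁]; simp
    rw [hq, gradient_quad, this]
    simp
  have hqH : hessian q x = (2 * m) • rankOne e₁ := by
    rw [hq, hessian_quad]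
    simp
  have hsplit : ((0 : E n), jet (fun y => u (refl l y)) x - jet u x) =
      (0, 0, 0, hessian (fun y => u (refl l y)) x - (hessian u x + hessian q x)) +
      ((0, q x, gradient q x, 0) + (2 * m) • ((0 : E n), (0 : ℝ), (0 : E n), rankOne e₁)) := by
    have h1 : u (refl l x) - u x = q x := by rw [hqg, hxval]
    simp only [jet, hgr, hqH]
    simp [h1]
    abel
  rw [hsplit, map_add, map_add, map_smul, smul_eq_mul] at hmvt
  have hn : ‖((0 : E n), q x, gradient q x, (0 : SymMat n))‖ ≤ 2 * m * η := by
    have hg2 : g x ≤ 2 * η ^ 2 := by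
      simp only [hg]
      nlinarith [sq_nonneg (x 0 - l)]
    have h1 : |q x| ≤ 2 * m * η := by
      rw [hqg, abs_mul, abs_neg, abs_of_pos hm0, abs_of_pos (hgpos x hxQ)]
      calc m * g x ≤ m * (2 * η) := by
            gcongr
            nlinarith
        _ = 2 * m * η := by ring
    have h2 : ‖gradient q x‖ ≤ 2 * m * η := by
      rw [hqgr, norm_smul, norm_e₁, mul_one, Real.norm_eq_abs, abs_of_nonneg
        (mul_nonneg (by positivity) (by linarith))]
      gcongr
      linarith
    simp only [Prod.norm_mk, max_le_iff, Real.norm_eq_abs, norm_zero]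
    exact ⟨by positivity, h1, h2, by positivity⟩
  have h7 := (abs_le.1 (hb1 (0, q x, gradient q x, 0))).1
  have h8 : C * ‖((0 : E n), q x, gradient q x, (0 : SymMat n))‖ ≤ C * (2 * m * η) := by gcongr
  have h9 : 2 * m * c₀ ≤ 2 * m * opDeriv F (x, j) (0, 0, 0, rankOne e₁) := by gcongr
  have h10 : C * (2 * m * η) ≤ 2 * m * (c₀ / 2) := by
    calc C * (2 * m * η) = 2 * m * (C * η) := by ring
      _ ≤ 2 * m * (c₀ / 2) := by gcongr
  have h11 : 0 < m * c₀ := by positivity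
  linarith

end Problem

/-! ### Moving the plane, and Hopf's lemma on it -/

namespace Problem

variable [NeZero n] {F : Jet n → ℝ} {u : E n → ℝ}

theorem reflLE_of_strip {η l : ℝ} (hη : 1 < l + η)
    (hstrip : (∀ x ∈ closedBall (0 : E n) 1, l + η ≤ x 0 → refl l x ≠ 0 → u x ≤ u (refl l x)) →
      ReflLE u l) : ReflLE u l := by
  refine hstrip fun x hx h => ?_
  have := (le_abs_self _).trans ((abs_zero_le_norm x).trans (mem_closedBall_zero_iff.1 hx))
  linarith

/-- Strictness holds on the compact set `x₁ ≥ l + η / 2` of the closed ball, sphere included, so it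
survives small changes of `l`. For `l'` near `l` this set contains `x₁ ≥ l' + η`, and the strip
principle covers the rest. -/
theorem eventually_reflLE (hP : Problem F u) {l₀ η l : ℝ} (hl₀ : 0 < l₀) (hη : 0 < η)
    (hstrip : ∀ l, l₀ ≤ l →
      (∀ x ∈ closedBall (0 : E n) 1, l + η ≤ x 0 → refl l x ≠ 0 → u x ≤ u (refl l x)) →
      ReflLE u l) (hl : l₀ < l) (hl1 : l < 1) (hle : ReflLE u l) :
    ∀ᶠ l' in 𝓝 l, ReflLE u l' := by
  have hl0 : 0 < l := hl₀.trans hl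
  have hKc : IsCompact (closedBall (0 : E n) 1 ∩ {x | l + η / 2 ≤ x 0}) :=
    (isCompact_closedBall _ _).inter_right (isClosed_le continuous_const (continuous_coord 0))
  have hne : ∀ x : E n, 0 < x 0 → x ≠ 0 := by
    rintro x hx rfl
    simp at hx
  have hev : ∀ᶠ l' in 𝓝 l, ∀ x ∈ closedBall (0 : E n) 1 ∩ {x | l + η / 2 ≤ x 0},
      x ∈ puncturedClosedBall n → StrictAt u l' x := by
    refine hKc.eventually_forall_of_forall_eventually fun x hx => ?_
    have hlx : l < x 0 := lt_of_lt_of_le (by linarith) hx.2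
    have hxp : x ∈ puncturedClosedBall n := ⟨hx.1, hne x (hl0.trans hlx)⟩
    have hs : StrictAt u l x := by
      rcases (mem_closedBall.1 hx.1).lt_or_eq with h | h
      · exact hP.strictAt_cap hl0 hl1 hle ⟨h, hlx⟩
      · exact hP.strictAt_sphere hl0 h hlx
    have h := hs.eventually hP.continuousOn_u hxp
    rw [← nhdsWithin_univ l, ← nhdsWithin_prod_eq, eventually_nhdsWithin_iff] at h
    filter_upwards [h] with p hp hp2
    exact hp ⟨mem_univ _, hp2⟩
  filter_upwards [hev, lt_mem_nhds hl, lt_mem_nhds (show l - η / 2 < l by linarith)] with l' h1 h2 h3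
  refine hstrip l' h2.le fun x hx hlx hr => ?_
  have hl'0 : 0 < l' := hl₀.trans h2
  have hxp : x ∈ puncturedClosedBall n := ⟨hx, hne x (by linarith)⟩
  refine ((h1 x ⟨hx, ?_⟩ hxp).lt ⟨?_, hr⟩).le
  · simp only [mem_ofPred_eq]; linarith
  · rw [mem_closedBall_zero_iff]
    exact (norm_refl_le hl'0.le (by linarith)).trans (mem_closedBall_zero_iff.1 hx)

theorem reflLE_of_forall_gt (hP : Problem F u) {l : ℝ} (hl : 0 < l) (hl1 : l < 1)
    (h : ∀ l', l < l' → l' < 1 → ReflLE u l') : ReflLE u l := by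
  intro x hx hlx h0
  rcases hlx.eq_or_lt with heq | hlt
  · rw [refl_eq_self heq.symm]
  have hc : Continuous fun l' : ℝ => refl l' x :=
    continuous_refl.comp (by fun_prop : Continuous fun l' : ℝ => (l', x))
  have hmem : ∀ l' : ℝ, 0 < l' → l' < x 0 → refl l' x ≠ 0 → refl l' x ∈ puncturedClosedBall n :=
    fun l' h1 h2 h3 => mem_puncturedClosedBall.2
      ⟨(norm_refl_le h1.le h2.le).trans (mem_closedBall_zero_iff.1 hx), h3⟩
  have hev : ∀ᶠ l' in 𝓝[>] l, l' < 1 ∧ l < l' ∧ l' < x 0 ∧ refl l' x ≠ 0 := by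
    filter_upwards [nhdsWithin_le_nhds (gt_mem_nhds hl1), self_mem_nhdsWithin,
      nhdsWithin_le_nhds (gt_mem_nhds hlt),
      nhdsWithin_le_nhds (hc.continuousAt.eventually_ne h0)] with l' h1 h2 h3 h4
    exact ⟨h1, h2, h3, h4⟩
  have ht : Tendsto (fun l' => u (refl l' x)) (𝓝[>] l) (𝓝 (u (refl l x))) := by
    refine (hP.continuousOn_u _ (hmem l hl hlt h0)).tendsto.comp
      (tendsto_nhdsWithin_iff.2 ⟨hc.continuousAt.tendsto.mono_left nhdsWithin_le_nhds, ?_⟩)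
    exact hev.mono fun l' h' => hmem l' (hl.trans h'.2.1) h'.2.2.1 h'.2.2.2
  exact ge_of_tendsto ht (hev.mono fun l' h' => h l' h'.2.1 h'.1 x hx h'.2.2.1.le h'.2.2.2)

/-- The reflected inequality holds for all hyperplanes `x₁ = l` with `0 < l < 1`. -/
theorem reflLE (hP : Problem F u) {l : ℝ} (hl : 0 < l) (hl1 : l < 1) : ReflLE u l := by
  obtain ⟨η, hη, hstrip⟩ := hP.exists_strip_width (half_pos hl)
  set S : Set ℝ := {t | t < 1 ∧ l ≤ t ∧ ∀ s, t ≤ s → s < 1 → ReflLE u s} with hS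
  have hne : S.Nonempty := by
    -- For `l` this close to `1` the whole cap lies in the strip of width `η`.
    have h1 : max l (1 - η / 2) < 1 := max_lt hl1 (by linarith)
    refine ⟨max l (1 - η / 2), h1, le_max_left _ _, fun s hs hs1 => ?_⟩
    have h2 := (le_max_left _ _).trans hs
    have h3 := (le_max_right _ _).trans hs
    exact reflLE_of_strip (by linarith) (hstrip s (by linarith))
  have hbdd : BddBelow S := ⟨l, fun t ht => ht.2.1⟩
  set σ := sInf S with hσ
  have hlσ : l ≤ σ := le_csInf hne fun t ht => ht.2.1
  have hσ1 : σ < 1 := by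
    obtain ⟨t, ht⟩ := hne
    exact (csInf_le hbdd ht).trans_lt ht.1
  have hgt : ∀ s, σ < s → s < 1 → ReflLE u s := fun s hs hs1 => by
    obtain ⟨t, ht, hts⟩ := exists_lt_of_csInf_lt hne hs
    exact ht.2.2 s hts.le hs1
  have hσle : ReflLE u σ := hP.reflLE_of_forall_gt (hl.trans_le hlσ) hσ1 hgt
  rcases hlσ.eq_or_lt with heq | hlt
  · rwa [heq]
  exfalso
  have hev := hP.eventually_reflLE (half_pos hl) hη hstrip (by linarith : l / 2 < σ) hσ1 hσle
  obtain ⟨ε, hε, hb⟩ := Metric.eventually_nhds_iff_ball.1 hev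
  have hmem : max l (σ - ε / 2) ∈ S := by
    refine ⟨max_lt hl1 (by linarith), le_max_left _ _, fun s hs hs1 => ?_⟩
    rcases lt_or_ge σ s with h | h
    · exact hgt s h hs1
    · refine hb s ?_
      rw [Real.ball_eq_Ioo]
      exact ⟨by linarith [(le_max_right _ _).trans hs], by linarith⟩
  have := csInf_le hbdd hmem
  rw [← hσ] at this
  rcases le_max_iff.1 this with h | h <;> linarith

/-- Hopf's lemma on the hyperplane. -/
theorem fderiv_neg (hP : Problem F u) {z : E n} (hz : z ∈ ball (0 : E n) 1) (hz0 : 0 < z 0)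
    (hz1 : z 0 < 1) : fderiv ℝ u z e₁ < 0 := by
  set l := z 0 with hl
  have hle : ReflLE u l := hP.reflLE hz0 hz1
  have hzp : z ∈ puncturedBall n := by
    refine ⟨hz, ?_⟩
    rintro rfl
    simp [hl] at hz0
  have hν : ‖-(e₁ : E n)‖ = 1 := by simp
  -- With `ν = -e₁` and `ρ = 1` the touching ball is centred at `z + e₁` and tangent to the
  -- hyperplane at `z`.
  obtain ⟨K, hK, r₀, hr₀, hr4, hKr, hrρ, hzr, δ₀, hδ₀, hbar⟩ := hP.barrier hzp hν one_pos
  set r := min r₀ (l / 2) with hr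
  have hr0 : 0 < r := lt_min hr₀ (half_pos hz0)
  have hrr : r ≤ r₀ := min_le_left _ _
  have hrl : r ≤ l / 2 := min_le_right _ _
  have hKr' : K * r ≤ 1 := le_trans (by gcongr) hKr
  set Q : Set (E n) := closedBall z r ∩ {x | l ≤ x 0} with hQ
  have hQc : IsCompact Q := (isCompact_closedBall _ _).inter_right
    (isClosed_le continuous_const (continuous_coord 0))
  have hQr : Q ⊆ closedBall z r₀ := fun x hx => closedBall_subset_closedBall hrr hx.1
  have hQb : ∀ x ∈ Q, x ∈ ball (0 : E n) 1 := fun x hx => (hzr (hQr hx)).1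
  have hQ0 : ∀ x ∈ Q, refl l x ≠ 0 := by
    intro x hx h
    have h1 : |(x - z) 0| ≤ r :=
      (abs_zero_le_norm _).trans (by rw [← dist_eq_norm]; exact hx.1)
    have h2 : (refl l x) 0 = 0 := by simp [h]
    rw [refl_zero] at h2
    have h3 := (abs_le.1 h1).2
    simp only [PiLp.sub_apply] at h3
    linarith
  have hQm : ∀ x ∈ Q, refl l x ∈ puncturedBall n := fun x hx =>
    refl_mem_puncturedBall hz0.le (hQb x hx) hx.2 (hQ0 x hx)
  have hQw : ∀ x ∈ Q, u x ≤ u (refl l x) := fun x hx =>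
    hle x (ball_subset_closedBall (hQb x hx)) hx.2 (hQ0 x hx)
  have hwc : ContinuousOn (fun x => u (refl l x) - u x) Q := by
    refine ContinuousOn.sub ?_ ?_
    · exact hP.continuousOn_u.comp (continuous_refl_right l).continuousOn fun x hx =>
        puncturedBall_subset (hQm x hx)
    · exact hP.continuousOn_u.mono fun x hx => puncturedBall_subset (hzr (hQr hx))
  have hSQ : sphere z r ∩ {x | l ≤ x 0} ⊆ Q := inter_subset_inter_left _ sphere_subset_closedBall
  obtain ⟨δ, hδ, hδδ, hδs⟩ := exists_smul_hopfBarrier_lt hν one_pos hK hr0 hKr' (hrr.trans hrρ)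
    (hrr.trans hr4) hδ₀ ((isCompact_sphere z r).inter_right
      (isClosed_le continuous_const (continuous_coord 0))) inter_subset_left (hwc.mono hSQ)
    (fun x hx => sub_nonneg.2 (hQw x (hSQ hx))) (fun x hx hxb => by
      refine sub_pos.2 ((hP.strictAt_cap hz0 hz1 hle ⟨hQb x (hSQ hx), ?_⟩).lt
        (puncturedBall_subset (hQm x (hSQ hx))))
      -- On the hyperplane `‖x - z - e₁‖² = r² + 1 > 1`, so the touching ball meets the sphere only
      -- in the open cap, where strictness is known.
      refine lt_of_le_of_ne hx.2 fun h => ?_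
      have h1 : ‖(x - z) - e₁‖ ≤ 1 := by
        rw [mem_closedBall, dist_eq_norm] at hxb
        refine le_trans (le_of_eq ?_) hxb
        congr 1
        module
      have h2 : ‖x - z‖ = r := by rw [← dist_eq_norm]; exact hx.1
      have h3 : ‖(x - z) - e₁‖ ^ 2 ≤ 1 ^ 2 := by gcongr
      have h4 : (x - z) 0 = 0 := by simp [← h, hl]
      rw [norm_sub_sq_real, real_inner_comm, inner_e₁, h4, h2, norm_e₁] at h3
      nlinarith)
  have hmain := hP.barrier_le hz0 hν one_pos hK hr₀ hr4 hKr hrρ hzr (A := 0)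
    (by rw [norm_zero]; exact hδ.le) hδ
    (fun x hx c hc hcδ => hbar x hx δ hδ hδδ 0 (by rw [norm_zero]; exact hδ.le) c hc hcδ)
    hQc hQr (fun x hx _ => ⟨hQ0 x hx, hx.2, hQw x hx⟩) (fun x hx hxz => by
      rw [inner_zero_left, zero_add]
      rcases (mem_closedBall.1 hx.1).lt_or_eq with hlt | heq
      · rcases (show l ≤ x 0 from hx.2).eq_or_lt with h | h
        · left
          rw [refl_eq_self h.symm, sub_self]
          have h4 : (x - z) 0 = 0 := by simp [← h, hl]
          -- On the flat face the terms in `⟨ν, x - z⟩` vanish and `-‖x - z‖²` remains, while the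
          -- reflected difference is zero.
          have h5 : hopfBarrier z (-e₁) 1 K x ≤ 0 := by
            simp only [hopfBarrier, quad, inner_neg_left, inner_e₁, h4, neg_neg]
            norm_num
          exact mul_nonpos_of_nonneg_of_nonpos hδ.le h5
        · refine Or.inr ⟨?_, h⟩
          have ho : IsOpen (ball z r ∩ {x | l < x 0}) :=
            isOpen_ball.inter (isOpen_lt continuous_const (continuous_coord 0))
          refine mem_of_superset (ho.mem_nhds ⟨hlt, h⟩) ?_
          rintro x' ⟨h1, h2⟩
          simp only [mem_ofPred_eq] at h2
          exact ⟨ball_subset_closedBall h1, h2.le⟩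
      · exact Or.inl (by linarith [hδs x ⟨heq, hx.2⟩]))
  -- differentiate at the centre
  set q := quad z (-e₁ : E n) (-0) (0 - δ • (-e₁)) (-(δ / 1)) (δ * K) with hq
  have hqz : q z = 0 := by simp [hq, quad]
  set φ : E n → ℝ := fun y => u (refl l y) - u y - q y with hφ
  have hrz : refl l z = z := refl_eq_self rfl
  have hrzp : refl l z ∈ puncturedBall n := by rwa [hrz]
  have dU := (hP.contDiffAt_refl hrzp).differentiableAt (by norm_num)
  have dV := (hP.contDiffAt hzp).differentiableAt (by norm_num)
  have dq : DifferentiableAt ℝ q z :=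
    (contDiff_quad (m := 1) _ _ _ _ _ _).contDiffAt.differentiableAt (by norm_num)
  have dUV : DifferentiableAt ℝ (fun y => u (refl l y) - u y) z := dU.sub dV
  have dφ : DifferentiableAt ℝ φ z := dUV.sub dq
  have hgrad : gradient φ z = hatVec (gradient u z) - gradient u z - δ • e₁ := by
    rw [hφ, gradient_sub dUV dq, gradient_sub dU dV, gradient_comp_refl (by rwa [hrz]),
      hrz, hq, gradient_quad]
    simp
  have hval : fderiv ℝ φ z e₁ = -2 * fderiv ℝ u z e₁ - δ := by
    rw [← inner_gradient φ, hgrad, inner_sub_left, inner_sub_left, inner_hatVec, inner_gradient,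
      inner_gradient, hatVec_eq, inner_smul_left, inner_e₁, e₁_zero]
    simp only [map_sub, map_smul, smul_eq_mul, conj_trivial]
    ring
  have hder : HasDerivAt (fun t : ℝ => φ (z + t • e₁)) (fderiv ℝ φ z e₁) 0 := by
    have h1 : HasDerivAt (fun t : ℝ => z + t • (e₁ : E n)) e₁ 0 := by
      simpa using ((hasDerivAt_id (0 : ℝ)).smul_const (e₁ : E n)).const_add z
    have h2 : HasFDerivAt φ (fderiv ℝ φ z) (z + (0 : ℝ) • e₁) := by simpa using dφ.hasFDerivAt
    exact h2.comp_hasDerivAt 0 h1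
  -- Since `φ` vanishes at `z` and is nonnegative along `z + t e₁` for small `t > 0`, its one-sided
  -- slope is nonnegative. This gives `-2 ∂u/∂x₁ ≥ δ > 0`.
  have hnn : 0 ≤ fderiv ℝ φ z e₁ := by
    refine ge_of_tendsto hder.tendsto_slope_zero_right ?_
    filter_upwards [self_mem_nhdsWithin, nhdsWithin_le_nhds (gt_mem_nhds hr0)] with t ht htr
    have ht0 : 0 < t := ht
    have hzQ : z + t • e₁ ∈ Q := by
      refine ⟨?_, ?_⟩
      · rw [mem_closedBall, dist_eq_norm, add_sub_cancel_left, norm_smul, norm_e₁, mul_one,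
          Real.norm_eq_abs, abs_of_pos ht0]
        exact htr.le
      · simp [hl, ht0.le]
    have hne : z + t • e₁ ≠ z := by
      simp [ht0.ne', e₁_ne_zero]
    have h1 := hmain _ hzQ hne
    have h2 : φ z = 0 := by simp [hφ, hrz, hqz]
    have h3 : 0 ≤ φ (z + t • e₁) := by
      simp only [hφ, hq]
      rw [quad_eq_hopfBarrier]
      linarith
    rw [zero_add, zero_smul, add_zero, h2, sub_zero, smul_eq_mul]
    positivity
  rw [hval] at hnn
  linarith

end Problem

end MovingPlanes

theorem theorem1p4 (n : ℕ) [NeZero n]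
    (F : MovingPlanes.Jet n → ℝ)
    (hF : ContDiffOn ℝ 1 F (MovingPlanes.puncturedClosedBall n ×ˢ Set.univ))
    (hell : MovingPlanes.Elliptic F)
    (hrefl : MovingPlanes.ReflectionMonotone F)
    (u : MovingPlanes.E n → ℝ)
    (hu : ContDiffOn ℝ 2 u (MovingPlanes.puncturedClosedBall n))
    (hsup : ∃ R : ℝ, 0 < R ∧ R ≤ 1 ∧ MovingPlanes.SuperaffineNearZero u R)
    (heq : ∀ x ∈ MovingPlanes.puncturedBall n,
      F (x, u x, gradient u x, MovingPlanes.hessian u x) = 0)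
    (hpos : ∀ x ∈ MovingPlanes.puncturedBall n, 0 < u x)
    (hbdry : ∀ x ∈ Metric.sphere (0 : MovingPlanes.E n) 1, u x = 0) :
    ∀ x ∈ Metric.ball (0 : MovingPlanes.E n) 1, 0 < x 0 → x 0 < 1 →
      fderiv ℝ u x (EuclideanSpace.single 0 1) < 0 := by
  intro x hx hx0 hx1
  have hP : MovingPlanes.Problem F u := ⟨hF, hell, hrefl, hu, hsup, heq, hpos, hbdry⟩
  exact hP.fderiv_neg hx hx0 hx1
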